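/- **Setting.** Let $\Omega=\Lambda\cup\Upsilon$ be a set of finitary function symbols, presented as the disjoint union of a set $\Lambda$ of *lower* symbols and a set $\Upsilon$ of *upper* symbols (arity $0$ is allowed). *Algebras.* An $\Omega$-lattice is a bounded lattice $(L,\wedge,\vee,0,1)$ with an operation of the right arity for each symbol of $\Omega$. It is an $\Omega$-NLO if each lower symbol denotes a normal operator (it preserves finite joins, including $0$, in each coordinate) and each upper symbol a normal dual operator (it preserves finite meets, including $1$, in each coordinate). A variety is an equationally definable class of $\Omega$-lattices. *Polarities.* For $R\subseteq X\times Y$, $A\subseteq X$, $B\subseteq Y$ put $\rho A=\{y: xRy\text{ for all }x\in A\}$ and $\lambda B=\{x: xRy\text{ for all }y\in B\}$; $A$ is stable if $A=\lambda\rho A$, $B$ is stable if $B=\rho\lambda B$. Write $x\le_1x'$ iff $\rho\{x\}\subseteq\rho\{x'\}$ and $y\le_2y'$ iff $\lambda\{y\}\subseteq\lambda\{y'\}$, lifted coordinatewise to tuples. An $\Omega$-polarity is a structure $P=(X,Y,R,\{S_f\}_{f\in\Lambda},\{T_g\}_{g\in\Upsilon})$ with $R\subseteq X\times Y$, $S_f\subseteq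 X^n\times Y$ for $n$-ary $f\in\Lambda$ and $T_g\subseteq X\times Y^m$ for $m$-ary $g\in\Upsilon$, such that every section of every $S_f$ and $T_g$ (the subset of $X$ or $Y$ obtained by fixing all coordinates but one) is stable. The sets $X$ and $Y$ may be empty. *The dual algebra $P^+$* is the $\Omega$-NLO of all stable subsets of $X$, ordered by inclusion (so $A\wedge B=A\cap B$ and $A\vee B=\lambda\rho(A\cup B)$), in which $f\in\Lambda$ is interpreted by $(A_i)_i\mapsto\lambda\{y:\vec xS_fy\text{ for all }\vec x\in\prod_i A_i\}$ and $g\in\Upsilon$ by $(A_i)_i\mapsto\{x: xT_g\vec y\text{ for all }\vec y\in\prod_i\rho A_i\}$. *The canonical structure $L_+$* of an $\Omega$-NLO $L$ is the $\Omega$-polarity in which $X$ is the set of non-empty filters of $L$, $Y$ is the set of non-empty ideals of $L$, $F\,R\,D$ iff $F\cap D\neq\emptyset$, $\vec F\,S_f\,D$ iff $f(\vec a)\in D$ for some $\vec a\in\prod_i F_i$, and $F\,T_g\,\vec D$ iff $g(\vec a)\in F$ for some $\vec a\in\prod_i D_i$. The canonical extension of an $\Omega$-polarity $P$ is $(P^+)_+$.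 *Morphisms.* A bounded morphism $P\to P'$ is a pair of maps $\alpha:X\to X'$, $\beta:Y\to Y'$, isotone for $\le_1$ and for $\le_2$ respectively, such that for all elements and tuples of the appropriate kind and all $f\in\Lambda$, $g\in\Upsilon$: - if $\alpha(x)R'\beta(y)$ then $xRy$; if $\alpha(\vec x)S'_f\beta(y)$ then $\vec xS_fy$; if $\alpha(x)T'_g\beta(\vec y)$ then $xT_g\vec y$; - if $xRy$ for all $x$ with $x'\le_1\alpha(x)$, then $x'R'\beta(y)$; if $xRy$ for all $y$ with $y'\le_2\beta(y)$, then $\alpha(x)R'y'$; - if $\vec xS_fy$ for all $\vec x$ with $\vec{x}'\le_1\alpha(\vec x)$, then $\vec{x}'S'_f\beta(y)$; if $xT_g\vec y$ for all $\vec y$ with $\vec{y}'\le_2\beta(\vec y)$, then $\alpha(x)T'_g\vec{y}'$. A filter $F$ of $L$ is i-maximal if, for some non-empty ideal $D$, it is maximal among the non-empty filters disjoint from $D$. A maximal covering morphism is a bounded morphism $(\alpha,\beta):P\to L_+$, for some $\Omega$-NLO $L$, such that the image of $\alpha$ contains every i-maximal filter of $L$. $P$ is an inner substructure of $P'$ if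 $X\subseteq X'$, $Y\subseteq Y'$, the relations of $P$ are the restrictions of those of $P'$, and the pair of inclusion maps is a bounded morphism $P\to P'$. *Direct sums.* The direct sum of a family $\{P_j:j\in J\}$ indexed by a (possibly empty) set $J$ is the $\Omega$-polarity on the disjoint unions of the $X_j$ and of the $Y_j$ in which $(x,j)R(y,k)$ iff $j\ne k$, or $j=k$ and $xR_ky$; $((x_i,j_i))_i\,S_f\,(y,k)$ iff $j_i\neq k$ for some $i$, or all $j_i=k$ and $\vec x(S_k)_fy$; and $(x,k)\,T_g\,((y_i,j_i))_i$ iff $j_i\ne k$ for some $i$, or all $j_i=k$ and $x(T_k)_g\vec y$. **Theorem.** Let $\mathcal S$ be a class of $\Omega$-polarities that is closed under canonical extensions: if $P\in\mathcal S$ then $(P^+)_+\in\mathcal S$. Then the following are equivalent. 1. $\mathcal S=\{P:P^+\in\mathcal V\}$ for some variety $\mathcal V$ of $\Omega$-lattices. 2. $\mathcal S$ reflects canonical extensions (if $(P^+)_+\in\mathcal S$ then $P\in\mathcal S$), is closed under direct sums (if all $P_j\in\mathcal S$ then $\sum_JP_j\in\mathcal S$), is closed under inner substructures, and is closed under codomains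 of maximal covering morphisms (if there is a maximal covering morphism $P\to L_+$ and $P\in\mathcal S$, then $L_+\in\mathcal S$). 3. $\mathcal S$ reflects canonical extensions, is closed under direct sums, is closed under inner substructures, and is closed under images of surjective morphisms (if there is a bounded morphism $(\alpha,\beta):P\to P'$ with $\alpha$ surjective and $P\in\mathcal S$, then $P'\in\mathcal S$). -/

import Mathlib

open Order

universe u v

/-- A set `Ω` of finitary function symbols, presented as the disjoint union of a set of lower
symbols and a set of upper symbols. -/
structure OmegaSignature where
  Lower : Type u
  Upper : Type u
  lowerArity : Lower → ℕ
  upperArity : Upper → ℕ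

/-! ### `Ω`-lattices, normal lattices with operators, varieties -/

/-- An `Ω`-lattice: a bounded lattice with an operation of the right arity for every symbol. -/
structure OmegaLattice (Ω : OmegaSignature.{u}) where
  carrier : Type u
  [lattice : Lattice carrier]
  [boundedOrder : BoundedOrder carrier]
  low (f : Ω.Lower) : (Fin (Ω.lowerArity f) → carrier) → carrier
  up (g : Ω.Upper) : (Fin (Ω.upperArity g) → carrier) → carrier

attribute [instance] OmegaLattice.lattice OmegaLattice.boundedOrder

/-- A normal operator: it preserves all finite joins (binary and empty) in each coordinate. -/
structure IsNormalOperator {L : Type u} [Lattice L] [BoundedOrder L] {n : ℕ}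
    (f : (Fin n → L) → L) : Prop where
  map_sup : ∀ (a : Fin n → L) (i : Fin n) (b c : L),
    f (Function.update a i (b ⊔ c)) = f (Function.update a i b) ⊔ f (Function.update a i c)
  map_bot : ∀ (a : Fin n → L) (i : Fin n), f (Function.update a i ⊥) = ⊥

/-- A normal dual operator: it preserves all finite meets (binary and empty) in each coordinate. -/
structure IsNormalDualOperator {L : Type u} [Lattice L] [BoundedOrder L] {n : ℕ}
    (g : (Fin n → L) → L) : Prop where
  map_inf : ∀ (a : Fin n → L) (i : Fin n) (b c : L),
    g (Function.update a i (b ⊓ c)) = g (Function.update a i b) ⊓ g (Function.update a i c)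
  map_top : ∀ (a : Fin n → L) (i : Fin n), g (Function.update a i ⊤) = ⊤

/-- A normal lattice with operators (`Ω`-NLO). -/
structure OmegaNLO (Ω : OmegaSignature.{u}) extends OmegaLattice Ω where
  low_normal : ∀ f, IsNormalOperator (low f)
  up_normal : ∀ g, IsNormalDualOperator (up g)

/-- Terms of the language of `Ω`-lattices, over a type `ν` of variables. -/
inductive OmegaTerm (Ω : OmegaSignature.{u}) (ν : Type v) : Type (max u v) where
  | var (k : ν) : OmegaTerm Ω ν
  | bot : OmegaTerm Ω ν
  | top : OmegaTerm Ω ν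
  | inf (s t : OmegaTerm Ω ν) : OmegaTerm Ω ν
  | sup (s t : OmegaTerm Ω ν) : OmegaTerm Ω ν
  | low (f : Ω.Lower) (t : Fin (Ω.lowerArity f) → OmegaTerm Ω ν) : OmegaTerm Ω ν
  | up (g : Ω.Upper) (t : Fin (Ω.upperArity g) → OmegaTerm Ω ν) : OmegaTerm Ω ν

/-- The value of a term in an `Ω`-lattice under an assignment of the variables. -/
def OmegaTerm.eval {Ω : OmegaSignature.{u}} {ν : Type v} (L : OmegaLattice Ω)
    (a : ν → L.carrier) : OmegaTerm Ω ν → L.carrier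
  | .var k => a k
  | .bot => ⊥
  | .top => ⊤
  | .inf s t => s.eval L a ⊓ t.eval L a
  | .sup s t => s.eval L a ⊔ t.eval L a
  | .low f t => L.low f (fun i => (t i).eval L a)
  | .up g t => L.up g (fun i => (t i).eval L a)

/-- An `Ω`-lattice satisfies the equation `s ≈ t`. -/
def OmegaLattice.Satisfies {Ω : OmegaSignature.{u}} {ν : Type v} (L : OmegaLattice Ω)
    (s t : OmegaTerm Ω ν) : Prop :=
  ∀ a : ν → L.carrier, s.eval L a = t.eval L a

/-- A variety: the class of all `Ω`-lattices that satisfy some set of equations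
(in countably many variables). -/
def IsVariety {Ω : OmegaSignature.{u}} (V : Set (OmegaLattice Ω)) : Prop :=
  ∃ E : Set (OmegaTerm Ω ℕ × OmegaTerm Ω ℕ), V = {L | ∀ e ∈ E, L.Satisfies e.1 e.2}

/-! ### `Ω`-polarities -/

/-- A structure `(X, Y, R, {S_f}, {T_g})` with `R ⊆ X × Y`, `S_f ⊆ Xⁿ × Y` and `T_g ⊆ X × Yᵐ`. -/
structure PolarityStructure (Ω : OmegaSignature.{u}) where
  X : Type u
  Y : Type u
  R : X → Y → Prop
  S (f : Ω.Lower) : (Fin (Ω.lowerArity f) → X) → Y → Prop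
  T (g : Ω.Upper) : X → (Fin (Ω.upperArity g) → Y) → Prop

/-- All sections of the relations `S_f` and `T_g` are stable. With `ρ = upperPolar R` and
`λ = lowerPolar R`, Mathlib's `IsExtent R A` says that `A ⊆ X` is of the form `λ B`, equivalently
`λ (ρ A) = A`, and `IsIntent R B` says that `B ⊆ Y` is of the form `ρ A`, equivalently
`ρ (λ B) = B`. -/
structure PolarityStructure.SectionsStable {Ω : OmegaSignature.{u}}
    (P : PolarityStructure Ω) : Prop where
  S_right : ∀ f x, IsIntent P.R {y | P.S f x y}
  S_left : ∀ f x i y, IsExtent P.R {x' | P.S f (Function.update x i x') y}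
  T_left : ∀ g y, IsExtent P.R {x | P.T g x y}
  T_right : ∀ g x y i, IsIntent P.R {y' | P.T g x (Function.update y i y')}

/-- An `Ω`-polarity. -/
structure OmegaPolarity (Ω : OmegaSignature.{u}) extends PolarityStructure Ω where
  stable : toPolarityStructure.SectionsStable

theorem isExtent_iff_forall_notMem {α β : Type u} {r : α → β → Prop} {s : Set α} :
    IsExtent r s ↔ ∀ a, a ∉ s → ∃ b ∈ upperPolar r s, ¬ r a b := by
  rw [isExtent_iff]
  constructor
  · intro h a ha
    by_contra! hc
    exact ha (h ▸ (fun b hb => hc b hb))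
  · intro h
    refine Set.Subset.antisymm (fun a ha => ?_) (subset_lowerPolar_upperPolar r s)
    by_contra hs
    obtain ⟨b, hb, hab⟩ := h a hs
    exact hab (ha hb)

theorem isIntent_iff_forall_notMem {α β : Type u} {r : α → β → Prop} {t : Set β} :
    IsIntent r t ↔ ∀ b, b ∉ t → ∃ a ∈ lowerPolar r t, ¬ r a b :=
  isExtent_iff_forall_notMem (r := Function.swap r)

/-! ### The stable set lattice `P⁺` -/

/-- The stable subsets of `X`. -/
def StableSet {X Y : Type u} (R : X → Y → Prop) : Type u := {A : Set X // IsExtent R A}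

namespace StableSet

variable {X Y : Type u} {R : X → Y → Prop}

instance : PartialOrder (StableSet R) := inferInstanceAs (PartialOrder {A : Set X // IsExtent R A})

instance : Lattice (StableSet R) where
  inf A B := ⟨A.1 ∩ B.1, A.2.inter B.2⟩
  inf_le_left _ _ := Set.inter_subset_left
  inf_le_right _ _ := Set.inter_subset_right
  le_inf _ _ _ h₁ h₂ := Set.subset_inter h₁ h₂
  sup A B := ⟨lowerPolar R (upperPolar R (A.1 ∪ B.1)), isExtent_lowerPolar⟩
  le_sup_left _ _ := Set.subset_union_left.trans (subset_lowerPolar_upperPolar R _)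
  le_sup_right _ _ := Set.subset_union_right.trans (subset_lowerPolar_upperPolar R _)
  sup_le _ _ C h₁ h₂ := C.2.lowerPolar_upperPolar_subset (Set.union_subset h₁ h₂)

instance : BoundedOrder (StableSet R) where
  top := ⟨Set.univ, IsExtent.univ⟩
  le_top _ := Set.subset_univ _
  bot := ⟨lowerPolar R Set.univ, isExtent_lowerPolar⟩
  bot_le A := by
    obtain ⟨B, hB⟩ := A.2
    exact (lowerPolar_anti R (Set.subset_univ B)).trans hB.le

end StableSet

namespace OmegaPolarity

variable {Ω : OmegaSignature.{u}}

/-- `f_S A = λ {y | (A₀ × ⋯ × Aₙ₋₁) S y}`. -/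
def lowerOp (P : OmegaPolarity Ω) (f : Ω.Lower)
    (A : Fin (Ω.lowerArity f) → StableSet P.R) : StableSet P.R :=
  ⟨lowerPolar P.R {y | ∀ x, (∀ i, x i ∈ (A i).1) → P.S f x y}, isExtent_lowerPolar⟩

/-- `g_T A = {x | x T (ρ A₀ × ⋯ × ρ Aₘ₋₁)}`. -/
def upperOp (P : OmegaPolarity Ω) (g : Ω.Upper)
    (A : Fin (Ω.upperArity g) → StableSet P.R) : StableSet P.R :=
  ⟨{x | ∀ y, (∀ i, y i ∈ upperPolar P.R (A i).1) → P.T g x y}, by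
    rw [isExtent_iff_forall_notMem]
    intro x hx
    simp only [Set.mem_ofPred_eq, not_forall] at hx
    obtain ⟨y, hy, hxy⟩ := hx
    obtain ⟨b, hb, hxb⟩ := isExtent_iff_forall_notMem.1 (P.stable.T_left g y) x hxy
    exact ⟨b, fun x' hx' => hb (hx' y hy), hxb⟩⟩

theorem isNormalOperator_lowerOp (P : OmegaPolarity Ω) (f : Ω.Lower) :
    IsNormalOperator (P.lowerOp f) := by
  have mono : ∀ (A : Fin (Ω.lowerArity f) → StableSet P.R) i (B C : StableSet P.R), B ≤ C →
      P.lowerOp f (Function.update A i B) ≤ P.lowerOp f (Function.update A i C) := by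
    intro A i B C hBC
    refine lowerPolar_anti P.R (fun y hy x hx => hy x (fun j => ?_))
    have := hx j
    by_cases hj : j = i
    · subst hj
      simp only [Function.update_self] at this ⊢
      exact hBC this
    · simpa [Function.update_of_ne hj] using this
  -- `y ∈ ρ (f_S (A[B/i]))` gives `B ⊆ S[x[-]_i, y]` for every `x` in the product of the `Aⱼ`
  have key : ∀ (A : Fin (Ω.lowerArity f) → StableSet P.R) i (B : StableSet P.R) y,
      y ∈ upperPolar P.R (P.lowerOp f (Function.update A i B)).1 →
      ∀ x : Fin (Ω.lowerArity f) → P.X, (∀ j, j ≠ i → x j ∈ (A j).1) →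
      B.1 ⊆ {x' | P.S f (Function.update x i x') y} := by
    intro A i B y hy x hx x' hx'
    by_contra hS
    obtain ⟨a, ha, hay⟩ :=
      isIntent_iff_forall_notMem.1 (P.stable.S_right f (Function.update x i x')) y hS
    refine hay (hy (fun b hb => ha (hb _ (fun j => ?_))))
    by_cases hj : j = i
    · subst hj; simpa using hx'
    · simpa [Function.update_of_ne hj] using hx j hj
  refine ⟨fun A i B C => le_antisymm ?_ (sup_le (mono _ _ _ _ le_sup_left)
    (mono _ _ _ _ le_sup_right)), fun A i => le_antisymm ?_ bot_le⟩
  · intro x hx y hy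
    have hB := key A i B y (fun a ha => hy (Or.inl ha))
    have hC := key A i C y (fun a ha => hy (Or.inr ha))
    refine hx (fun z hz => ?_)
    have hz' : ∀ j, j ≠ i → z j ∈ (A j).1 := fun j hj => by
      simpa [Function.update_of_ne hj] using hz j
    have hsub := (P.stable.S_left f z i y).lowerPolar_upperPolar_subset
      (Set.union_subset (hB z hz') (hC z hz'))
    have hzi := hz i
    rw [Function.update_self] at hzi
    simpa using hsub hzi
  · intro x hx y _
    refine hx (fun z hz => ?_)
    have hzi := hz i
    rw [Function.update_self] at hzi
    have : (⊥ : StableSet P.R) ≤ ⟨_, P.stable.S_left f z i y⟩ := bot_le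
    simpa using this hzi

theorem isNormalDualOperator_upperOp (P : OmegaPolarity Ω) (g : Ω.Upper) :
    IsNormalDualOperator (P.upperOp g) := by
  have mono : ∀ (A : Fin (Ω.upperArity g) → StableSet P.R) i (B C : StableSet P.R), B ≤ C →
      P.upperOp g (Function.update A i B) ≤ P.upperOp g (Function.update A i C) := by
    intro A i B C hBC x hx y hy
    refine hx y (fun j => ?_)
    have := hy j
    by_cases hj : j = i
    · subst hj
      simp only [Function.update_self] at this ⊢
      exact upperPolar_anti P.R hBC this
    · simpa [Function.update_of_ne hj] using this
  -- `x ∈ g_T (A[B/i])` gives `ρ B ⊆ T[x, y[-]_i]` for every `y` in the product of the `ρ Aⱼ`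
  have key : ∀ (A : Fin (Ω.upperArity g) → StableSet P.R) i (B : StableSet P.R) x,
      x ∈ (P.upperOp g (Function.update A i B)).1 →
      ∀ y : Fin (Ω.upperArity g) → P.Y, (∀ j, j ≠ i → y j ∈ upperPolar P.R (A j).1) →
      upperPolar P.R B.1 ⊆ {y' | P.T g x (Function.update y i y')} := by
    intro A i B x hx y hy y' hy'
    refine hx _ (fun j => ?_)
    by_cases hj : j = i
    · subst hj; simpa using hy'
    · simpa [Function.update_of_ne hj] using hy j hj
  refine ⟨fun A i B C => le_antisymm (le_inf (mono _ _ _ _ inf_le_left)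
    (mono _ _ _ _ inf_le_right)) ?_, fun A i => le_antisymm le_top ?_⟩
  · rintro x ⟨hB, hC⟩ y hy
    have hy' : ∀ j, j ≠ i → y j ∈ upperPolar P.R (A j).1 := fun j hj => by
      simpa [Function.update_of_ne hj] using hy j
    have hyi := hy i
    rw [Function.update_self] at hyi
    by_contra hT
    have hT' : y i ∉ {y' | P.T g x (Function.update y i y')} := by simpa using hT
    obtain ⟨a, ha, hay⟩ := isIntent_iff_forall_notMem.1 (P.stable.T_right g x y i) _ hT'
    refine hay (hyi ⟨?_, ?_⟩)
    · rw [← isExtent_iff.1 B.2]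
      exact fun b hb => ha (key A i B x hB y hy' hb)
    · rw [← isExtent_iff.1 C.2]
      exact fun b hb => ha (key A i C x hC y hy' hb)
  · intro x _ y hy
    have hyi := hy i
    rw [Function.update_self] at hyi
    by_contra hT
    have hT' : y i ∉ {y' | P.T g x (Function.update y i y')} := by simpa using hT
    obtain ⟨a, ha, hay⟩ := isIntent_iff_forall_notMem.1 (P.stable.T_right g x y i) _ hT'
    exact hay (hyi trivial)

/-- The stable set lattice `P⁺` of an `Ω`-polarity, as an `Ω`-NLO. -/
abbrev dual (P : OmegaPolarity Ω) : OmegaNLO Ω where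
  carrier := StableSet P.R
  low := P.lowerOp
  up := P.upperOp
  low_normal := P.isNormalOperator_lowerOp
  up_normal := P.isNormalDualOperator_upperOp

end OmegaPolarity

/-! ### The canonical structure `L₊` of an `Ω`-NLO -/

theorem IsNormalOperator.mono {L : Type u} [Lattice L] [BoundedOrder L] {n : ℕ}
    {f : (Fin n → L) → L} (hf : IsNormalOperator f) : Monotone f := by
  have step : ∀ (a : Fin n → L) i b, a i ≤ b → f a ≤ f (Function.update a i b) := by
    intro a i b hab
    have := hf.map_sup a i (a i) b
    rw [sup_eq_right.2 hab, Function.update_eq_self] at this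
    rw [this]
    exact le_sup_left
  intro a b hab
  have ind : ∀ s : Finset (Fin n), f a ≤ f (s.piecewise b a) := by
    intro s
    induction s using Finset.induction_on with
    | empty => simp
    | insert i s hi ih =>
      rw [Finset.piecewise_insert]
      refine ih.trans (step _ _ _ ?_)
      rw [Finset.piecewise_eq_of_notMem _ _ _ hi]
      exact hab i
  simpa using ind Finset.univ

theorem IsNormalDualOperator.mono {L : Type u} [Lattice L] [BoundedOrder L] {n : ℕ}
    {g : (Fin n → L) → L} (hg : IsNormalDualOperator g) : Monotone g := by
  have step : ∀ (a : Fin n → L) i b, a i ≤ b → g a ≤ g (Function.update a i b) := by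
    intro a i b hab
    have := hg.map_inf a i (a i) b
    rw [inf_eq_left.2 hab, Function.update_eq_self] at this
    rw [this]
    exact inf_le_right
  intro a b hab
  have ind : ∀ s : Finset (Fin n), g a ≤ g (s.piecewise b a) := by
    intro s
    induction s using Finset.induction_on with
    | empty => simp
    | insert i s hi ih =>
      rw [Finset.piecewise_insert]
      refine ih.trans (step _ _ _ ?_)
      rw [Finset.piecewise_eq_of_notMem _ _ _ hi]
      exact hab i
  simpa using ind Finset.univ

namespace OmegaNLO

variable {Ω : OmegaSignature.{u}}

/-- The underlying structure of `L₊`: points are the non-empty filters and the non-empty ideals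
of `L`, and a filter is related to an ideal when the two intersect. -/
abbrev canonicalBase (L : OmegaNLO Ω) : PolarityStructure Ω where
  X := PFilter L.carrier
  Y := Ideal L.carrier
  R F D := ∃ a, a ∈ F ∧ a ∈ D
  S f F D := ∃ a : Fin (Ω.lowerArity f) → L.carrier, (∀ i, a i ∈ F i) ∧ L.low f a ∈ D
  T g F D := ∃ a : Fin (Ω.upperArity g) → L.carrier, (∀ i, a i ∈ D i) ∧ L.up g a ∈ F

theorem sectionsStable_canonicalBase (L : OmegaNLO Ω) : L.canonicalBase.SectionsStable where
  S_right := fun f (F : Fin (Ω.lowerArity f) → PFilter L.carrier) => by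
    have mono := (L.low_normal f).mono
    have hG : IsPFilter {b | ∃ a : Fin (Ω.lowerArity f) → L.carrier,
        (∀ i, a i ∈ F i) ∧ L.low f a ≤ b} := by
      refine IsPFilter.of_def ?_ ?_ ?_
      · exact ⟨_, fun _ => ⊤, fun i => PFilter.top_mem, le_rfl⟩
      · rintro b ⟨a, ha, hab⟩ b' ⟨a', ha', hab'⟩
        exact ⟨b ⊓ b', ⟨a ⊓ a', fun i => PFilter.inf_mem (ha i) (ha' i),
          le_inf ((mono inf_le_left).trans hab) ((mono inf_le_right).trans hab')⟩,
          inf_le_left, inf_le_right⟩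
      · rintro b b' hbb ⟨a, ha, hab⟩
        exact ⟨a, ha, hab.trans hbb⟩
    rw [isIntent_iff_forall_notMem]
    intro (D : Ideal L.carrier) hD
    refine ⟨hG.toPFilter, ?_, ?_⟩
    · rintro (E : Ideal L.carrier) ⟨a, ha, haE⟩
      exact ⟨_, ⟨a, ha, le_rfl⟩, haE⟩
    · rintro ⟨b, ⟨a, ha, hab⟩, hbD⟩
      exact hD ⟨a, ha, D.lower hab hbD⟩
  S_left := fun f (F : Fin (Ω.lowerArity f) → PFilter L.carrier) i (D : Ideal L.carrier) => by
    have mono := (L.low_normal f).mono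
    have hE : IsIdeal {b | ∃ a : Fin (Ω.lowerArity f) → L.carrier,
        (∀ j, j ≠ i → a j ∈ F j) ∧ L.low f (Function.update a i b) ∈ D} := by
      refine ⟨?_, ?_, ?_⟩
      · rintro b b' hbb ⟨a, ha, haD⟩
        exact ⟨a, ha, D.lower (mono (update_le_update_iff.2 ⟨hbb, fun _ _ => le_rfl⟩)) haD⟩
      · refine ⟨⊥, fun _ => ⊤, fun j _ => PFilter.top_mem, ?_⟩
        rw [(L.low_normal f).map_bot]
        exact D.bot_mem
      · rintro b ⟨a, ha, hab⟩ b' ⟨a', ha', hab'⟩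
        refine ⟨b ⊔ b', ⟨a ⊓ a', fun j hj => PFilter.inf_mem (ha j hj) (ha' j hj), ?_⟩,
          le_sup_left, le_sup_right⟩
        rw [(L.low_normal f).map_sup]
        refine Ideal.sup_mem (D.lower (mono ?_) hab) (D.lower (mono ?_) hab')
        · exact update_le_update_iff.2 ⟨le_rfl, fun j _ => inf_le_left⟩
        · exact update_le_update_iff.2 ⟨le_rfl, fun j _ => inf_le_right⟩
    rw [isExtent_iff_forall_notMem]
    intro (G : PFilter L.carrier) hG
    refine ⟨hE.toIdeal, ?_, ?_⟩
    · rintro (H : PFilter L.carrier) ⟨a, ha, haD⟩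
      have hai : a i ∈ H := by simpa using ha i
      refine ⟨a i, hai, a, fun j hj => ?_, by simpa using haD⟩
      have := ha j
      rwa [Function.update_of_ne hj] at this
    · rintro ⟨b, hbG, a, ha, haD⟩
      refine hG ⟨Function.update a i b, fun j => ?_, haD⟩
      by_cases hj : j = i
      · subst hj; simpa using hbG
      · rw [Function.update_of_ne hj, Function.update_of_ne hj]
        exact ha j hj
  T_left := fun g (D : Fin (Ω.upperArity g) → Ideal L.carrier) => by
    have mono := (L.up_normal g).mono
    have hE : IsIdeal {b | ∃ a : Fin (Ω.upperArity g) → L.carrier,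
        (∀ i, a i ∈ D i) ∧ b ≤ L.up g a} := by
      refine ⟨?_, ?_, ?_⟩
      · rintro b b' hbb ⟨a, ha, hab⟩
        exact ⟨a, ha, hbb.trans hab⟩
      · exact ⟨_, fun _ => ⊥, fun i => (D i).bot_mem, le_rfl⟩
      · rintro b ⟨a, ha, hab⟩ b' ⟨a', ha', hab'⟩
        exact ⟨b ⊔ b', ⟨a ⊔ a', fun i => Ideal.sup_mem (ha i) (ha' i),
          sup_le (hab.trans (mono le_sup_left)) (hab'.trans (mono le_sup_right))⟩,
          le_sup_left, le_sup_right⟩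
    rw [isExtent_iff_forall_notMem]
    intro (F : PFilter L.carrier) hF
    refine ⟨hE.toIdeal, ?_, ?_⟩
    · rintro (G : PFilter L.carrier) ⟨a, ha, haG⟩
      exact ⟨_, haG, a, ha, le_rfl⟩
    · rintro ⟨b, hbF, a, ha, hab⟩
      exact hF ⟨a, ha, PFilter.mem_of_le hab hbF⟩
  T_right := fun g (F : PFilter L.carrier) (D : Fin (Ω.upperArity g) → Ideal L.carrier) i => by
    have mono := (L.up_normal g).mono
    have hG : IsPFilter {b | ∃ a : Fin (Ω.upperArity g) → L.carrier,
        (∀ j, j ≠ i → a j ∈ D j) ∧ L.up g (Function.update a i b) ∈ F} := by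
      refine IsPFilter.of_def ?_ ?_ ?_
      · refine ⟨⊤, fun _ => ⊥, fun j _ => (D j).bot_mem, ?_⟩
        rw [(L.up_normal g).map_top]
        exact PFilter.top_mem
      · rintro b ⟨a, ha, hab⟩ b' ⟨a', ha', hab'⟩
        refine ⟨b ⊓ b', ⟨a ⊔ a', fun j hj => Ideal.sup_mem (ha j hj) (ha' j hj), ?_⟩,
          inf_le_left, inf_le_right⟩
        rw [(L.up_normal g).map_inf]
        refine PFilter.inf_mem (PFilter.mem_of_le (mono ?_) hab)
          (PFilter.mem_of_le (mono ?_) hab')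
        · exact update_le_update_iff.2 ⟨le_rfl, fun j _ => le_sup_left⟩
        · exact update_le_update_iff.2 ⟨le_rfl, fun j _ => le_sup_right⟩
      · rintro b b' hbb ⟨a, ha, haF⟩
        exact ⟨a, ha, PFilter.mem_of_le (mono (update_le_update_iff.2 ⟨hbb, fun _ _ => le_rfl⟩)) haF⟩
    rw [isIntent_iff_forall_notMem]
    intro (E : Ideal L.carrier) hE
    refine ⟨hG.toPFilter, ?_, ?_⟩
    · rintro (H : Ideal L.carrier) ⟨a, ha, haF⟩
      have hai : a i ∈ H := by simpa using ha i
      refine ⟨a i, ⟨a, fun j hj => ?_, by simpa using haF⟩, hai⟩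
      have := ha j
      rwa [Function.update_of_ne hj] at this
    · rintro ⟨b, ⟨a, ha, haF⟩, hbE⟩
      refine hE ⟨Function.update a i b, fun j => ?_, haF⟩
      by_cases hj : j = i
      · subst hj; simpa using hbE
      · rw [Function.update_of_ne hj, Function.update_of_ne hj]
        exact ha j hj

/-- The canonical structure `L₊` of an `Ω`-NLO. -/
abbrev canonicalStructure (L : OmegaNLO Ω) : OmegaPolarity Ω where
  toPolarityStructure := L.canonicalBase
  stable := L.sectionsStable_canonicalBase

/-- A filter is i-maximal if, for some (non-empty) ideal `D`, it is maximal among the (non-empty)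
filters that are disjoint from `D`. -/
def IsIMaximal (L : OmegaNLO Ω) (F : PFilter L.carrier) : Prop :=
  ∃ D : Ideal L.carrier,
    Maximal (fun G : PFilter L.carrier => Disjoint (G : Set L.carrier) (D : Set L.carrier)) F

end OmegaNLO

/-- The canonical extension `(P⁺)₊` of an `Ω`-polarity. -/
abbrev OmegaPolarity.canonicalExtension {Ω : OmegaSignature.{u}} (P : OmegaPolarity Ω) :
    OmegaPolarity Ω :=
  P.dual.canonicalStructure

/-! ### Bounded morphisms -/

namespace PolarityStructure

variable {Ω : OmegaSignature.{u}}

/-- The quasi-order `x ≤₁ x'` iff `ρ {x} ⊆ ρ {x'}`. -/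
def le₁ (P : PolarityStructure Ω) (x x' : P.X) : Prop :=
  upperPolar P.R {x} ⊆ upperPolar P.R {x'}

/-- The quasi-order `y ≤₂ y'` iff `λ {y} ⊆ λ {y'}`. -/
def le₂ (P : PolarityStructure Ω) (y y' : P.Y) : Prop :=
  lowerPolar P.R {y} ⊆ lowerPolar P.R {y'}

/-- The pair `α, β` is a bounded morphism from `P` to `P'`. -/
structure IsBoundedMorphism (P P' : PolarityStructure Ω) (α : P.X → P'.X) (β : P.Y → P'.Y) :
    Prop where
  isotone₁ : ∀ x z, P.le₁ x z → P'.le₁ (α x) (α z)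
  isotone₂ : ∀ y w, P.le₂ y w → P'.le₂ (β y) (β w)
  R₁ : ∀ x y, P'.R (α x) (β y) → P.R x y
  R₂ : ∀ x' y, (∀ x, P'.le₁ x' (α x) → P.R x y) → P'.R x' (β y)
  R₃ : ∀ x y', (∀ y, P'.le₂ y' (β y) → P.R x y) → P'.R (α x) y'
  S₁ : ∀ f x y, P'.S f (fun i => α (x i)) (β y) → P.S f x y
  S₂ : ∀ f x' y, (∀ x, (∀ i, P'.le₁ (x' i) (α (x i))) → P.S f x y) → P'.S f x' (β y)
  T₁ : ∀ g x y, P'.T g (α x) (fun i => β (y i)) → P.T g x y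
  T₂ : ∀ g x y', (∀ y, (∀ i, P'.le₂ (y' i) (β (y i))) → P.T g x y) → P'.T g (α x) y'

/-- The substructure of `P` on `A ⊆ X` and `B ⊆ Y`, with the restricted relations. -/
abbrev restrict (P : PolarityStructure Ω) (A : Set P.X) (B : Set P.Y) : PolarityStructure Ω where
  X := A
  Y := B
  R x y := P.R x y
  S f x y := P.S f (fun i => (x i : P.X)) y
  T g x y := P.T g x (fun i => (y i : P.Y))

/-- The direct sum of a family of structures, on the disjoint unions of the `Xⱼ` and of the `Yⱼ`:
`(x, j) R (y, k)` iff either `j ≠ k`, or `j = k` and `x R_k y`; `S_f` and `T_g` are similar. -/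
abbrev directSum {J : Type u} (P : J → PolarityStructure Ω) : PolarityStructure Ω where
  X := Σ j, (P j).X
  Y := Σ j, (P j).Y
  R p q := p.1 ≠ q.1 ∨ ∃ x : (P q.1).X, p = ⟨q.1, x⟩ ∧ (P q.1).R x q.2
  S f p q := (∃ i, (p i).1 ≠ q.1) ∨
    ∃ x : Fin (Ω.lowerArity f) → (P q.1).X, (∀ i, p i = ⟨q.1, x i⟩) ∧ (P q.1).S f x q.2
  T g p q := (∃ i, (q i).1 ≠ p.1) ∨
    ∃ y : Fin (Ω.upperArity g) → (P p.1).Y, (∀ i, q i = ⟨p.1, y i⟩) ∧ (P p.1).T g p.2 y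

section DirectSum

variable {J : Type u} (P : J → PolarityStructure Ω)

theorem directSum_R_of_ne {p : Σ j, (P j).X} {q : Σ j, (P j).Y} (h : p.1 ≠ q.1) :
    (directSum P).R p q :=
  Or.inl h

theorem directSum_R_self {k : J} (x : (P k).X) (y : (P k).Y) :
    (directSum P).R ⟨k, x⟩ ⟨k, y⟩ ↔ (P k).R x y := by
  constructor
  · rintro (h | ⟨x', hx, h⟩)
    · exact absurd rfl h
    · cases hx; exact h
  · exact fun h => Or.inr ⟨x, rfl, h⟩

theorem directSum_S_self {k : J} (f : Ω.Lower) (x : Fin (Ω.lowerArity f) → (P k).X) (y : (P k).Y) :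
    (directSum P).S f (fun i => ⟨k, x i⟩) ⟨k, y⟩ ↔ (P k).S f x y := by
  constructor
  · rintro (⟨i, h⟩ | ⟨x', hx, h⟩)
    · exact absurd rfl h
    · have : x = x' := funext fun i => eq_of_heq (Sigma.mk.inj (hx i)).2
      rwa [this]
  · exact fun h => Or.inr ⟨x, fun _ => rfl, h⟩

theorem directSum_T_self {k : J} (g : Ω.Upper) (x : (P k).X) (y : Fin (Ω.upperArity g) → (P k).Y) :
    (directSum P).T g ⟨k, x⟩ (fun i => ⟨k, y i⟩) ↔ (P k).T g x y := by
  constructor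
  · rintro (⟨i, h⟩ | ⟨y', hy, h⟩)
    · exact absurd rfl h
    · have : y = y' := funext fun i => eq_of_heq (Sigma.mk.inj (hy i)).2
      rwa [this]
  · exact fun h => Or.inr ⟨y, fun _ => rfl, h⟩

theorem sigma_family_eq {n : ℕ} {Z : J → Type u} {k : J} (p : Fin n → Σ j, Z j)
    (h : ∀ i, (p i).1 = k) : ∃ z : Fin n → Z k, p = fun i => ⟨k, z i⟩ := by
  have : ∀ i, ∃ z : Z k, p i = ⟨k, z⟩ := fun i => by
    have hi := h i
    generalize p i = q at hi
    obtain ⟨j, z⟩ := q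
    cases hi
    exact ⟨z, rfl⟩
  choose z hz using this
  exact ⟨z, funext hz⟩

theorem exists_of_not_directSum_S {f : Ω.Lower} {p : Fin (Ω.lowerArity f) → Σ j, (P j).X}
    {k : J} {y : (P k).Y} (h : ¬ (directSum P).S f p ⟨k, y⟩) :
    ∃ x : Fin (Ω.lowerArity f) → (P k).X, p = (fun i => ⟨k, x i⟩) ∧ ¬ (P k).S f x y := by
  obtain ⟨x, rfl⟩ := sigma_family_eq p (k := k) fun i => by
    by_contra hc
    exact h (Or.inl ⟨i, hc⟩)
  exact ⟨x, rfl, fun hS => h ((directSum_S_self P f x y).2 hS)⟩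

theorem exists_of_not_directSum_T {g : Ω.Upper} {q : Fin (Ω.upperArity g) → Σ j, (P j).Y}
    {k : J} {x : (P k).X} (h : ¬ (directSum P).T g ⟨k, x⟩ q) :
    ∃ y : Fin (Ω.upperArity g) → (P k).Y, q = (fun i => ⟨k, y i⟩) ∧ ¬ (P k).T g x y := by
  obtain ⟨y, rfl⟩ := sigma_family_eq q (k := k) fun i => by
    by_contra hc
    exact h (Or.inl ⟨i, hc⟩)
  exact ⟨y, rfl, fun hT => h ((directSum_T_self P g x y).2 hT)⟩

theorem update_sigma_family {n : ℕ} {Z : J → Type u} {k : J} {p : Fin n → Σ j, Z j} {i : Fin n}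
    {r : Σ j, Z j} {z : Fin n → Z k} (h : Function.update p i r = fun j => ⟨k, z j⟩) (a : Z k) :
    Function.update p i ⟨k, a⟩ = fun j => ⟨k, Function.update z i a j⟩ := by
  funext j
  by_cases hj : j = i
  · subst hj; simp
  · have := congrFun h j
    rw [Function.update_of_ne hj] at this
    rw [Function.update_of_ne hj, Function.update_of_ne hj, this]

theorem sectionsStable_directSum (hP : ∀ j, (P j).SectionsStable) :
    (directSum P).SectionsStable where
  S_right f p := by
    rw [isIntent_iff_forall_notMem]
    rintro ⟨k, y⟩ hy
    obtain ⟨x, rfl, hxy⟩ := exists_of_not_directSum_S P hy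
    obtain ⟨a, ha, hay⟩ := isIntent_iff_forall_notMem.1 ((hP k).S_right f x) y hxy
    refine ⟨⟨k, a⟩, ?_, fun h => hay ((directSum_R_self P a y).1 h)⟩
    rintro ⟨l, w⟩ hw
    by_cases hl : k = l
    · subst hl
      exact (directSum_R_self P a w).2 (ha ((directSum_S_self P f x w).1 hw))
    · exact directSum_R_of_ne P hl
  S_left := fun f (p : Fin (Ω.lowerArity f) → Σ j, (P j).X) i q => by
    obtain ⟨k, y⟩ := q
    rw [isExtent_iff_forall_notMem]
    intro r hr
    obtain ⟨x, hx, hxy⟩ := exists_of_not_directSum_S P hr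
    have hri : r = ⟨k, x i⟩ := by simpa using congrFun hx i
    have hxi : x i ∉ {x' | (P k).S f (Function.update x i x') y} := by simpa using hxy
    obtain ⟨b, hb, hxb⟩ := isExtent_iff_forall_notMem.1 ((hP k).S_left f x i y) _ hxi
    refine ⟨⟨k, b⟩, ?_, fun h => hxb ((directSum_R_self P _ b).1 (hri ▸ h))⟩
    rintro ⟨l, a⟩ ha
    by_cases hl : l = k
    · subst hl
      refine (directSum_R_self P a b).2 (hb ?_)
      have ha' : (directSum P).S f (Function.update p i ⟨l, a⟩) ⟨l, y⟩ := ha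
      rw [update_sigma_family hx a] at ha'
      exact (directSum_S_self P f _ y).1 ha'
    · exact directSum_R_of_ne P hl
  T_left g q := by
    rw [isExtent_iff_forall_notMem]
    rintro ⟨k, x⟩ hx
    obtain ⟨y, rfl, hxy⟩ := exists_of_not_directSum_T P hx
    obtain ⟨b, hb, hxb⟩ := isExtent_iff_forall_notMem.1 ((hP k).T_left g y) x hxy
    refine ⟨⟨k, b⟩, ?_, fun h => hxb ((directSum_R_self P x b).1 h)⟩
    rintro ⟨l, w⟩ hw
    by_cases hl : l = k
    · subst hl
      exact (directSum_R_self P w b).2 (hb ((directSum_T_self P g w y).1 hw))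
    · exact directSum_R_of_ne P hl
  T_right := fun g p (q : Fin (Ω.upperArity g) → Σ j, (P j).Y) i => by
    obtain ⟨k, x⟩ := p
    rw [isIntent_iff_forall_notMem]
    intro r hr
    obtain ⟨y, hy, hxy⟩ := exists_of_not_directSum_T P hr
    have hri : r = ⟨k, y i⟩ := by simpa using congrFun hy i
    have hyi : y i ∉ {y' | (P k).T g x (Function.update y i y')} := by simpa using hxy
    obtain ⟨a, ha, hay⟩ := isIntent_iff_forall_notMem.1 ((hP k).T_right g x y i) _ hyi
    refine ⟨⟨k, a⟩, ?_, fun h => hay ((directSum_R_self P a _).1 (hri ▸ h))⟩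
    rintro ⟨l, b⟩ hb
    by_cases hl : k = l
    · subst hl
      refine (directSum_R_self P a b).2 (ha ?_)
      have hb' : (directSum P).T g ⟨k, x⟩ (Function.update q i ⟨k, b⟩) := hb
      rw [update_sigma_family hy b] at hb'
      exact (directSum_T_self P g x _).1 hb'
    · exact directSum_R_of_ne P hl

end DirectSum

end PolarityStructure

/-- The direct sum of a family of `Ω`-polarities. -/
abbrev OmegaPolarity.directSum {Ω : OmegaSignature.{u}} {J : Type u} (P : J → OmegaPolarity Ω) :
    OmegaPolarity Ω where
  toPolarityStructure := PolarityStructure.directSum fun j => (P j).toPolarityStructure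
  stable := PolarityStructure.sectionsStable_directSum _ fun j => (P j).stable

/-- A maximal covering morphism from `P` to a canonical structure `L₊`. -/
def IsMaximalCoveringMorphism {Ω : OmegaSignature.{u}} (P : OmegaPolarity Ω) (L : OmegaNLO Ω)
    (α : P.X → PFilter L.carrier) (β : P.Y → Ideal L.carrier) : Prop :=
  P.IsBoundedMorphism L.canonicalStructure.toPolarityStructure α β ∧
    ∀ F : PFilter L.carrier, L.IsIMaximal F → F ∈ Set.range α

/-- `P` is an inner substructure of `P'`: it is the restriction of `P'` to subsets `A ⊆ X'` and
`B ⊆ Y'`, and the pair of inclusion maps is a bounded morphism. -/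
def IsInnerSubstructure {Ω : OmegaSignature.{u}} (P P' : OmegaPolarity Ω) : Prop :=
  ∃ (A : Set P'.X) (B : Set P'.Y), P.toPolarityStructure = P'.restrict A B ∧
    (P'.restrict A B).IsBoundedMorphism P'.toPolarityStructure
      (Subtype.val : A → P'.X) (Subtype.val : B → P'.Y)

/-! ### Closure conditions on a class of `Ω`-polarities -/

section Closure

variable {Ω : OmegaSignature.{u}} (S : Set (OmegaPolarity Ω))

def ClosedUnderCanonicalExtensions : Prop :=
  ∀ P ∈ S, P.canonicalExtension ∈ S

def ReflectsCanonicalExtensions : Prop :=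
  ∀ P : OmegaPolarity Ω, P.canonicalExtension ∈ S → P ∈ S

def ClosedUnderDirectSums : Prop :=
  ∀ (J : Type u) (P : J → OmegaPolarity Ω), (∀ j, P j ∈ S) → OmegaPolarity.directSum P ∈ S

def ClosedUnderInnerSubstructures : Prop :=
  ∀ P P' : OmegaPolarity Ω, IsInnerSubstructure P P' → P' ∈ S → P ∈ S

/-- Only the first component `α` is required to be surjective. -/
def ClosedUnderSurjectiveImages : Prop :=
  ∀ (P P' : OmegaPolarity Ω) (α : P.X → P'.X) (β : P.Y → P'.Y),
    P.IsBoundedMorphism P'.toPolarityStructure α β → Function.Surjective α → P ∈ S → P' ∈ S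

def ClosedUnderMaximalCoveringCodomains : Prop :=
  ∀ (P : OmegaPolarity Ω) (L : OmegaNLO Ω) (α : P.X → PFilter L.carrier)
    (β : P.Y → Ideal L.carrier),
    IsMaximalCoveringMorphism P L α β → P ∈ S → L.canonicalStructure ∈ S

end Closure

/-! The proof combines a duality between algebras and polarities with Birkhoff's theorem.

A bounded morphism `P → P'` induces by preimage a homomorphism `P'⁺ → P⁺` (`isHom_dualMap`). It is
injective when `α` is surjective, and surjective for an inner inclusion. Conversely, a homomorphism
`L → M` induces a bounded morphism `M₊ → L₊` (`isBoundedMorphism_comap`). Its filter component is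
surjective when the homomorphism is injective, and a surjective homomorphism makes `M₊` isomorphic
to an inner substructure of `L₊`. Moreover `L` embeds in `(L₊)⁺`, and the dual of a direct sum
embeds in the product of the duals. Since equations pass to subalgebras, homomorphic images and
products, (1) implies (3).

For (3) implies (2), a stable set of `L₊` is determined by its i-maximal members, so a maximal
covering morphism `P → L₊` has an injective dual `(L₊)⁺ → P⁺`. Dualizing once more gives a morphism
from `(P⁺)₊` onto the canonical extension of `L₊`, and reflection yields `L₊`.

For (2) implies (1), let `P⁺` satisfy every equation valid in all duals of members of the class. One
direct sum `Q` of counterexamples to the invalid equations serves as the product in Birkhoff's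
argument: `P⁺` is a homomorphic image of a subalgebra `A` of `Q⁺`. Then `(Q⁺)₊` maps onto `A₊`,
`(P⁺)₊` is up to isomorphism an inner substructure of `A₊`, and reflection yields `P`. -/

/-! ### Homomorphisms and preservation of equations -/

namespace OmegaLattice

variable {Ω : OmegaSignature.{u}}

/-- A homomorphism of `Ω`-lattices. -/
structure IsHom (L M : OmegaLattice Ω) (θ : L.carrier → M.carrier) : Prop where
  map_bot : θ ⊥ = ⊥
  map_top : θ ⊤ = ⊤
  map_inf : ∀ a b, θ (a ⊓ b) = θ a ⊓ θ b
  map_sup : ∀ a b, θ (a ⊔ b) = θ a ⊔ θ b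
  map_low : ∀ f a, θ (L.low f a) = M.low f (fun i => θ (a i))
  map_up : ∀ g a, θ (L.up g a) = M.up g (fun i => θ (a i))

namespace IsHom

variable {L M : OmegaLattice Ω} {θ : L.carrier → M.carrier}

theorem mono (h : L.IsHom M θ) : Monotone θ := fun a b hab => by
  rw [← inf_eq_left, ← h.map_inf, inf_eq_left.2 hab]

theorem map_eval (h : L.IsHom M θ) {ν : Type v} (a : ν → L.carrier) (t : OmegaTerm Ω ν) :
    θ (t.eval L a) = t.eval M (fun k => θ (a k)) := by
  induction t with
  | var k => rfl
  | bot => exact h.map_bot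
  | top => exact h.map_top
  | inf s t hs ht => simp only [OmegaTerm.eval, h.map_inf, hs, ht]
  | sup s t hs ht => simp only [OmegaTerm.eval, h.map_sup, hs, ht]
  | low f t ih => simp only [OmegaTerm.eval, h.map_low, ih]
  | up g t ih => simp only [OmegaTerm.eval, h.map_up, ih]

theorem satisfies_of_surjective (h : L.IsHom M θ) (hθ : Function.Surjective θ) {ν : Type v}
    {s t : OmegaTerm Ω ν} (hL : L.Satisfies s t) : M.Satisfies s t := fun b => by
  choose a ha using fun k => hθ (b k)
  have := congrArg θ (hL a)
  simpa only [h.map_eval, ha] using this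

theorem satisfies_of_injective (h : L.IsHom M θ) (hθ : Function.Injective θ) {ν : Type v}
    {s t : OmegaTerm Ω ν} (hM : M.Satisfies s t) : L.Satisfies s t := fun a => hθ <| by
  rw [h.map_eval, h.map_eval, hM]

end IsHom

end OmegaLattice

/-! ### Equations in arbitrarily many variables -/

namespace OmegaTerm

variable {Ω : OmegaSignature.{u}}

/-- Renaming of variables. -/
def rename {ν : Type*} {μ : Type*} (r : ν → μ) : OmegaTerm Ω ν → OmegaTerm Ω μ
  | .var k => .var (r k)
  | .bot => .bot
  | .top => .top
  | .inf s t => .inf (s.rename r) (t.rename r)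
  | .sup s t => .sup (s.rename r) (t.rename r)
  | .low f t => .low f (fun i => (t i).rename r)
  | .up g t => .up g (fun i => (t i).rename r)

theorem eval_rename {ν : Type*} {μ : Type*} (r : ν → μ) (L : OmegaLattice Ω)
    (a : μ → L.carrier) (t : OmegaTerm Ω ν) :
    (t.rename r).eval L a = t.eval L (fun k => a (r k)) := by
  induction t with
  | var k => rfl
  | bot => rfl
  | top => rfl
  | inf s t hs ht => simp only [rename, OmegaTerm.eval, hs, ht]
  | sup s t hs ht => simp only [rename, OmegaTerm.eval, hs, ht]
  | low f t ih => simp only [rename, OmegaTerm.eval, ih]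
  | up g t ih => simp only [rename, OmegaTerm.eval, ih]

/-- The value of a term depends on finitely many variables only. -/
theorem exists_finite_support {ν : Type v} (t : OmegaTerm Ω ν) :
    ∃ W : Set ν, W.Finite ∧ ∀ (L : OmegaLattice Ω) (a b : ν → L.carrier),
      (∀ k ∈ W, a k = b k) → t.eval L a = t.eval L b := by
  induction t with
  | var k => exact ⟨{k}, Set.finite_singleton k, fun L a b h => h k rfl⟩
  | bot => exact ⟨∅, Set.finite_empty, fun _ _ _ _ => rfl⟩
  | top => exact ⟨∅, Set.finite_empty, fun _ _ _ _ => rfl⟩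
  | inf s t hs ht =>
    obtain ⟨W, hW, h⟩ := hs
    obtain ⟨W', hW', h'⟩ := ht
    refine ⟨W ∪ W', hW.union hW', fun L a b hab => ?_⟩
    simp only [eval, h L a b fun k hk => hab k (Or.inl hk), h' L a b fun k hk => hab k (Or.inr hk)]
  | sup s t hs ht =>
    obtain ⟨W, hW, h⟩ := hs
    obtain ⟨W', hW', h'⟩ := ht
    refine ⟨W ∪ W', hW.union hW', fun L a b hab => ?_⟩
    simp only [eval, h L a b fun k hk => hab k (Or.inl hk), h' L a b fun k hk => hab k (Or.inr hk)]
  | low f t ih =>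
    choose W hW h using ih
    refine ⟨⋃ i, W i, Set.finite_iUnion hW, fun L a b hab => ?_⟩
    simp only [eval, fun i => h i L a b fun k hk => hab k (Set.mem_iUnion_of_mem i hk)]
  | up g t ih =>
    choose W hW h using ih
    refine ⟨⋃ i, W i, Set.finite_iUnion hW, fun L a b hab => ?_⟩
    simp only [eval, fun i => h i L a b fun k hk => hab k (Set.mem_iUnion_of_mem i hk)]

/-- An equation in arbitrarily many variables is equivalent to one in countably many. -/
theorem exists_nat_equation {ν : Type v} (s t : OmegaTerm Ω ν) :
    ∃ s' t' : OmegaTerm Ω ℕ, ∀ L : OmegaLattice Ω, L.Satisfies s t ↔ L.Satisfies s' t' := by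
  obtain ⟨W, hW, hs⟩ := s.exists_finite_support
  obtain ⟨W', hW', ht⟩ := t.exists_finite_support
  obtain ⟨r, hr⟩ := Set.countable_iff_exists_injOn.1 (hW.union hW').countable
  refine ⟨s.rename r, t.rename r, fun L => ⟨fun h a => ?_, fun h a => ?_⟩⟩
  · rw [eval_rename, eval_rename, h]
  -- `Function.invFunOn` needs a point of `ν`; over an empty `ν` there is only one assignment.
  · rcases isEmpty_or_nonempty ν with hν | hν
    · have := h fun _ => ⊥
      rw [eval_rename, eval_rename] at this
      rwa [Subsingleton.elim a fun _ => ⊥]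
    -- Going along the partial inverse of `r` and back recovers `a` on the supports of the two terms
    -- only, and the values depend on nothing else.
    · have hinv := hr.leftInvOn_invFunOn
      have := h fun n => a (Function.invFunOn r (W ∪ W') n)
      rw [eval_rename, eval_rename] at this
      rw [hs L a _ fun k hk => congrArg a (hinv (Or.inl hk)).symm,
        ht L a _ fun k hk => congrArg a (hinv (Or.inr hk)).symm]
      exact this

end OmegaTerm

/-! ### Subalgebras generated by an assignment -/

namespace OmegaNLO

variable {Ω : OmegaSignature.{u}}

/-- A subset of an `Ω`-NLO that is closed under all operations, as an `Ω`-NLO. -/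
def subalgebra (M : OmegaNLO Ω) (C : Set M.carrier) (hbot : ⊥ ∈ C) (htop : ⊤ ∈ C)
    (hinf : ∀ a ∈ C, ∀ b ∈ C, a ⊓ b ∈ C) (hsup : ∀ a ∈ C, ∀ b ∈ C, a ⊔ b ∈ C)
    (hlow : ∀ f a, (∀ i, a i ∈ C) → M.low f a ∈ C)
    (hup : ∀ g a, (∀ i, a i ∈ C) → M.up g a ∈ C) : OmegaNLO Ω :=
  letI : Lattice C := Subtype.lattice (P := (· ∈ C)) (fun _ _ ha hb => hsup _ ha _ hb)
    (fun _ _ ha hb => hinf _ ha _ hb)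
  letI : BoundedOrder C := Subtype.boundedOrder hbot htop
  { carrier := C
    low := fun f a => ⟨M.low f fun i => a i, hlow f _ fun i => (a i).2⟩
    up := fun g a => ⟨M.up g fun i => a i, hup g _ fun i => (a i).2⟩
    low_normal := fun f => by
      have key : ∀ (a : Fin (Ω.lowerArity f) → C) i (b : C),
          (fun j => (Function.update a i b j : M.carrier)) =
            Function.update (fun j => (a j : M.carrier)) i b := fun a i b =>
        Function.comp_update (Subtype.val : C → M.carrier) a i b
      refine ⟨fun a i b c => Subtype.ext ?_, fun a i => Subtype.ext ?_⟩
      · change M.low f _ = M.low f _ ⊔ M.low f _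
        rw [key, key, key]
        exact (M.low_normal f).map_sup _ _ _ _
      · change M.low f _ = ⊥
        rw [key]
        exact (M.low_normal f).map_bot _ _
    up_normal := fun g => by
      have key : ∀ (a : Fin (Ω.upperArity g) → C) i (b : C),
          (fun j => (Function.update a i b j : M.carrier)) =
            Function.update (fun j => (a j : M.carrier)) i b := fun a i b =>
        Function.comp_update (Subtype.val : C → M.carrier) a i b
      refine ⟨fun a i b c => Subtype.ext ?_, fun a i => Subtype.ext ?_⟩
      · change M.up g _ = M.up g _ ⊓ M.up g _
        rw [key, key, key]
        exact (M.up_normal g).map_inf _ _ _ _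
      · change M.up g _ = ⊤
        rw [key]
        exact (M.up_normal g).map_top _ _ }

/-- If every equation that holds in `M` under the assignment `a` holds in `L` under the
assignment `b`, and `b` is onto, then `L` is a homomorphic image of a subalgebra of `M`. -/
theorem exists_span (L M : OmegaNLO Ω) {ν : Type v} (a : ν → M.carrier) (b : ν → L.carrier)
    (hb : Function.Surjective b)
    (h : ∀ s t : OmegaTerm Ω ν, s.eval M.toOmegaLattice a = t.eval M.toOmegaLattice a →
      s.eval L.toOmegaLattice b = t.eval L.toOmegaLattice b) :
    ∃ (A : OmegaNLO Ω) (ι : A.carrier → M.carrier) (π : A.carrier → L.carrier),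
      A.IsHom M.toOmegaLattice ι ∧ Function.Injective ι ∧
      A.IsHom L.toOmegaLattice π ∧ Function.Surjective π := by
  let ev : OmegaTerm Ω ν → M.carrier := fun t => t.eval M.toOmegaLattice a
  let A := M.subalgebra (Set.range ev) ⟨.bot, rfl⟩ ⟨.top, rfl⟩
    (by rintro _ ⟨s, rfl⟩ _ ⟨t, rfl⟩; exact ⟨.inf s t, rfl⟩)
    (by rintro _ ⟨s, rfl⟩ _ ⟨t, rfl⟩; exact ⟨.sup s t, rfl⟩)
    (by
      intro f x hx
      choose t ht using hx
      exact ⟨.low f t, congrArg (M.low f) (funext ht)⟩)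
    (by
      intro g x hx
      choose t ht using hx
      exact ⟨.up g t, congrArg (M.up g) (funext ht)⟩)
  -- The map `π` sends the value of a term under `a` to its value under `b`. By `h` the choice of
  -- the term is irrelevant, so each homomorphism law needs only one suitable term.
  let q : Set.range ev → OmegaTerm Ω ν := fun x => x.2.choose
  have hq : ∀ x, ev (q x) = x := fun x => x.2.choose_spec
  let π : Set.range ev → L.carrier := fun x => (q x).eval L.toOmegaLattice b
  have hπ : ∀ x t, ev t = x.1 → π x = t.eval L.toOmegaLattice b := fun x t ht =>
    h _ _ ((hq x).trans ht.symm)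
  refine ⟨A, (Subtype.val : Set.range ev → _), π, ⟨rfl, rfl, fun _ _ => rfl, fun _ _ => rfl,
    fun _ _ => rfl, fun _ _ => rfl⟩, Subtype.val_injective, ⟨hπ _ .bot rfl, hπ _ .top rfl,
    fun x y => hπ _ (.inf (q x) (q y)) ?_, fun x y => hπ _ (.sup (q x) (q y)) ?_,
    fun f x => hπ _ (.low f fun i => q (x i)) ?_, fun g x => hπ _ (.up g fun i => q (x i)) ?_⟩, ?_⟩
  · exact congrArg₂ (· ⊓ ·) (hq x) (hq y)
  · exact congrArg₂ (· ⊔ ·) (hq x) (hq y)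
  · exact congrArg (M.low f) (funext fun i => hq (x i))
  · exact congrArg (M.up g) (funext fun i => hq (x i))
  · intro c
    obtain ⟨k, rfl⟩ := hb c
    exact ⟨⟨ev (.var k), _, rfl⟩, hπ _ (.var k) rfl⟩

end OmegaNLO

/-! ### Composition and isomorphisms of bounded morphisms -/

namespace PolarityStructure

variable {Ω : OmegaSignature.{u}}

namespace IsBoundedMorphism

variable {P P' P'' : PolarityStructure Ω} {α : P.X → P'.X} {β : P.Y → P'.Y}
  {α' : P'.X → P''.X} {β' : P'.Y → P''.Y}

/-- Isotonicity is what lets the back conditions compose: an inequality below `α' z` followed by `z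
≤₁ α x` collapses to one below `α' (α x)`, and likewise for `β`. -/
theorem comp (h' : P'.IsBoundedMorphism P'' α' β') (h : P.IsBoundedMorphism P' α β) :
    P.IsBoundedMorphism P'' (fun x => α' (α x)) (fun y => β' (β y)) where
  isotone₁ _ _ hxz := h'.isotone₁ _ _ (h.isotone₁ _ _ hxz)
  isotone₂ _ _ hyw := h'.isotone₂ _ _ (h.isotone₂ _ _ hyw)
  R₁ _ _ hxy := h.R₁ _ _ (h'.R₁ _ _ hxy)
  R₂ _ _ hy := h'.R₂ _ _ fun _ hz => h.R₂ _ _ fun x hx => hy x (hz.trans (h'.isotone₁ _ _ hx))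
  R₃ _ _ hx := h'.R₃ _ _ fun _ hw => h.R₃ _ _ fun y hy => hx y (hw.trans (h'.isotone₂ _ _ hy))
  S₁ _ _ _ hxy := h.S₁ _ _ _ (h'.S₁ _ _ _ hxy)
  S₂ _ _ _ hy := h'.S₂ _ _ _ fun _ hz => h.S₂ _ _ _ fun x hx =>
    hy x fun i => (hz i).trans (h'.isotone₁ _ _ (hx i))
  T₁ _ _ _ hxy := h.T₁ _ _ _ (h'.T₁ _ _ _ hxy)
  T₂ _ _ _ hx := h'.T₂ _ _ _ fun _ hw => h.T₂ _ _ _ fun y hy =>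
    hx y fun i => (hw i).trans (h'.isotone₂ _ _ (hy i))

theorem le₂_of_R (h : P.IsBoundedMorphism P' α β) {x : P.X} {y' : P'.Y} {y : P.Y}
    (hx : P'.R (α x) y') (hy : P'.le₂ y' (β y)) : P.R x y :=
  h.R₁ _ _ (hy (a := α x) (fun _ hb => hb ▸ hx) rfl)

end IsBoundedMorphism

/-- Every `y ∈ ρ A` is related to `x`, hence to `x'`. This upward closure is what makes the back
conditions, phrased with `≤₁`, applicable to stable sets. -/
theorem mem_of_le₁ {P : PolarityStructure Ω} {A : Set P.X} (hA : IsExtent P.R A) {x x' : P.X}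
    (hx : x ∈ A) (h : P.le₁ x x') : x' ∈ A := by
  rw [← isExtent_iff.1 hA]
  exact fun y hy => h (a := y) (fun _ ha => ha ▸ hy hx) rfl

theorem mem_of_le₂ {P : PolarityStructure Ω} {B : Set P.Y} (hB : IsIntent P.R B) {y y' : P.Y}
    (hy : y ∈ B) (h : P.le₂ y y') : y' ∈ B := by
  rw [← isIntent_iff.1 hB]
  exact fun x hx => h (a := x) (fun _ hb => hb ▸ hx hy) rfl

/-- An isomorphism of structures. -/
structure Iso (P P' : PolarityStructure Ω) where
  toX : P.X ≃ P'.X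
  toY : P.Y ≃ P'.Y
  R_iff : ∀ x y, P'.R (toX x) (toY y) ↔ P.R x y
  S_iff : ∀ f x y, P'.S f (fun i => toX (x i)) (toY y) ↔ P.S f x y
  T_iff : ∀ g x y, P'.T g (toX x) (fun i => toY (y i)) ↔ P.T g x y

namespace Iso

variable {P P' : PolarityStructure Ω}

/-- The inverse of an isomorphism. -/
def symm (e : Iso P P') : Iso P' P where
  toX := e.toX.symm
  toY := e.toY.symm
  R_iff x y := by rw [← e.R_iff]; simp
  S_iff f x y := by rw [← e.S_iff]; simp
  T_iff g x y := by rw [← e.T_iff]; simp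

theorem le₁_iff (e : Iso P P') (x z : P.X) : P'.le₁ (e.toX x) (e.toX z) ↔ P.le₁ x z := by
  simp only [le₁, Set.subset_def, e.toY.forall_congr_left, upperPolar, Set.mem_ofPred_eq]
  simp [← e.R_iff]

theorem le₂_iff (e : Iso P P') (y w : P.Y) : P'.le₂ (e.toY y) (e.toY w) ↔ P.le₂ y w := by
  simp only [le₂, Set.subset_def, e.toX.forall_congr_left, lowerPolar, Set.mem_ofPred_eq]
  simp [← e.R_iff]

theorem isBoundedMorphism (e : Iso P P') : P.IsBoundedMorphism P' e.toX e.toY where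
  isotone₁ x z := (e.le₁_iff x z).2
  isotone₂ y w := (e.le₂_iff y w).2
  R₁ x y := (e.R_iff x y).1
  R₂ x' y h := by
    obtain ⟨x, rfl⟩ := e.toX.surjective x'
    exact (e.R_iff x y).2 (h x subset_rfl)
  R₃ x y' h := by
    obtain ⟨y, rfl⟩ := e.toY.surjective y'
    exact (e.R_iff x y).2 (h y subset_rfl)
  S₁ f x y := (e.S_iff f x y).1
  S₂ f x' y h := by
    choose x hx using fun i => e.toX.surjective (x' i)
    obtain rfl : (fun i => e.toX (x i)) = x' := funext hx
    exact (e.S_iff f x y).2 (h x fun i => subset_rfl)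
  T₁ g x y := (e.T_iff g x y).1
  T₂ g x y' h := by
    choose y hy using fun i => e.toY.surjective (y' i)
    obtain rfl : (fun i => e.toY (y i)) = y' := funext hy
    exact (e.T_iff g x y).2 (h y fun i => subset_rfl)

theorem isExtent (e : Iso P P') {A : Set P'.X} (h : IsExtent P.R (e.toX ⁻¹' A)) :
    IsExtent P'.R A := by
  rw [isExtent_iff_forall_notMem] at h ⊢
  intro x' hx'
  obtain ⟨x, rfl⟩ := e.toX.surjective x'
  obtain ⟨y, hy, hxy⟩ := h x hx'
  refine ⟨e.toY y, fun z' hz' => ?_, fun hR => hxy ((e.R_iff x y).1 hR)⟩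
  obtain ⟨z, rfl⟩ := e.toX.surjective z'
  exact (e.R_iff z y).2 (hy hz')

theorem isIntent (e : Iso P P') {B : Set P'.Y} (h : IsIntent P.R (e.toY ⁻¹' B)) :
    IsIntent P'.R B := by
  rw [isIntent_iff_forall_notMem] at h ⊢
  intro y' hy'
  obtain ⟨y, rfl⟩ := e.toY.surjective y'
  obtain ⟨x, hx, hxy⟩ := h y hy'
  refine ⟨e.toX x, fun z' hz' => ?_, fun hR => hxy ((e.R_iff x y).1 hR)⟩
  obtain ⟨z, rfl⟩ := e.toY.surjective z'
  exact (e.R_iff x z).2 (hx hz')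

/-- Needed to see that the substructure of `L₊` on the image of `M₊` is again an `Ω`-polarity. -/
theorem sectionsStable (e : Iso P P') (h : P.SectionsStable) : P'.SectionsStable where
  S_right f x' := by
    choose x hx using fun i => e.toX.surjective (x' i)
    obtain rfl : (fun i => e.toX (x i)) = x' := funext hx
    refine e.isIntent ?_
    convert h.S_right f x using 1
    exact Set.ext fun y => e.S_iff f x y
  S_left f x' i y' := by
    choose x hx using fun i => e.toX.surjective (x' i)
    obtain rfl : (fun i => e.toX (x i)) = x' := funext hx
    obtain ⟨y, rfl⟩ := e.toY.surjective y'
    refine e.isExtent ?_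
    convert h.S_left f x i y using 1
    refine Set.ext fun z => ?_
    rw [Set.mem_preimage, Set.mem_ofPred_eq, Set.mem_ofPred_eq, ← e.S_iff]
    rw [show (fun j => e.toX (Function.update x i z j)) =
      Function.update (fun j => e.toX (x j)) i (e.toX z) from Function.comp_update e.toX x i z]
  T_left g y' := by
    choose y hy using fun i => e.toY.surjective (y' i)
    obtain rfl : (fun i => e.toY (y i)) = y' := funext hy
    refine e.isExtent ?_
    convert h.T_left g y using 1
    exact Set.ext fun x => e.T_iff g x y
  T_right g x' y' i := by
    choose y hy using fun i => e.toY.surjective (y' i)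
    obtain rfl : (fun i => e.toY (y i)) = y' := funext hy
    obtain ⟨x, rfl⟩ := e.toX.surjective x'
    refine e.isIntent ?_
    convert h.T_right g x y i using 1
    refine Set.ext fun z => ?_
    rw [Set.mem_preimage, Set.mem_ofPred_eq, Set.mem_ofPred_eq, ← e.T_iff]
    rw [show (fun j => e.toY (Function.update y i z j)) =
      Function.update (fun j => e.toY (y j)) i (e.toY z) from Function.comp_update e.toY y i z]

end Iso

end PolarityStructure

/-! ### From bounded morphisms to homomorphisms of stable set lattices -/

namespace OmegaPolarity

variable {Ω : OmegaSignature.{u}}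

section DualMap

variable {P P' : OmegaPolarity Ω} {α : P.X → P'.X} {β : P.Y → P'.Y}

/-- Some `y' ∈ ρ A` separates `α x` from `A`. By the contrapositive of `R₃` it can be traded for a
`β y` above it with `y` not related to `x`; `β y` still lies in `ρ A`, and `R₁` brings this down to
`y`. -/
theorem isExtent_preimage (h : P.IsBoundedMorphism P'.toPolarityStructure α β) {A : Set P'.X}
    (hA : IsExtent P'.R A) : IsExtent P.R (α ⁻¹' A) := by
  rw [isExtent_iff_forall_notMem]
  intro x hx
  obtain ⟨y', hy', hxy⟩ := isExtent_iff_forall_notMem.1 hA _ hx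
  have : ∃ y, P'.le₂ y' (β y) ∧ ¬ P.R x y := by
    by_contra! hc
    exact hxy (h.R₃ x y' hc)
  obtain ⟨y, hy, hxy⟩ := this
  exact ⟨y, fun z hz => h.le₂_of_R (hy' hz) hy, hxy⟩

/-- One direction is `R₂`, because `A` is closed upwards; the other is `R₁`. It lets everything
computed through `ρ` commute with preimages. -/
theorem mem_upperPolar_iff (h : P.IsBoundedMorphism P'.toPolarityStructure α β) {A : Set P'.X}
    (hA : IsExtent P'.R A) (y : P.Y) :
    y ∈ upperPolar P.R (α ⁻¹' A) ↔ β y ∈ upperPolar P'.R A :=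
  ⟨fun hy _ hx' => h.R₂ _ _ fun _ hx => hy (PolarityStructure.mem_of_le₁ hA hx' hx),
    fun hy _ hx => h.R₁ _ _ (hy hx)⟩

/-- The map of stable set lattices that is induced by a bounded morphism. -/
def dualMap (h : P.IsBoundedMorphism P'.toPolarityStructure α β) (A : StableSet P'.R) :
    StableSet P.R :=
  ⟨α ⁻¹' A.1, isExtent_preimage h A.2⟩

/-- Preimages preserve meets and the top outright. For each operator one inclusion comes from the
back condition `S₂` or `T₂`, the other from the reflecting condition `S₁` or `T₁`. -/
theorem isHom_dualMap (h : P.IsBoundedMorphism P'.toPolarityStructure α β) :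
    P'.dual.IsHom P.dual.toOmegaLattice (dualMap h) where
  map_bot := by
    refine le_antisymm (fun x hx y _ => h.R₁ _ _ (hx trivial)) bot_le
  map_top := rfl
  map_inf _ _ := rfl
  map_sup A B := by
    refine le_antisymm ?_ (sup_le ?_ ?_)
    · intro x hx y hy
      refine h.R₁ _ _ (hx ?_)
      rintro x' (hx' | hx')
      · exact (mem_upperPolar_iff h A.2 y).1 (fun a ha => hy (Or.inl ha)) hx'
      · exact (mem_upperPolar_iff h B.2 y).1 (fun a ha => hy (Or.inr ha)) hx'
    · exact fun x hx => (le_sup_left : A ≤ A ⊔ B) hx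
    · exact fun x hx => (le_sup_right : B ≤ A ⊔ B) hx
  map_low f A := by
    refine le_antisymm ?_ ?_
    · refine fun x hx y hy => h.R₁ _ _ (hx fun x' hx' => h.S₂ _ _ _ fun z hz => hy z fun i => ?_)
      exact PolarityStructure.mem_of_le₁ (A i).2 (hx' i) (hz i)
    -- By `R₃` only `y` with `y' ≤₂ β y` matter. The section of `S_f` at `α z` is stable and
    -- contains `y'`, so it contains `β y`, and `S₁` applies.
    · refine fun x hx y' hy' => h.R₃ _ _ fun y hy => hx fun z hz => h.S₁ _ _ _ ?_
      exact PolarityStructure.mem_of_le₂ (P'.stable.S_right f _) (hy' (fun i => α (z i)) hz) hy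
  map_up g A := by
    refine le_antisymm ?_ ?_
    · exact fun x hx y hy => h.T₁ _ _ _ (hx _ fun i => (mem_upperPolar_iff h (A i).2 _).1 (hy i))
    · refine fun x hx y' hy' => h.T₂ _ _ _ fun y hy => hx y fun i => ?_
      exact (mem_upperPolar_iff h (A i).2 _).2
        (PolarityStructure.mem_of_le₂ isIntent_upperPolar (hy' i) (hy i))

theorem dualMap_injective (h : P.IsBoundedMorphism P'.toPolarityStructure α β)
    (hα : Function.Surjective α) : Function.Injective (dualMap h) := fun _ _ hAB =>
  Subtype.ext (hα.preimage_injective (congrArg Subtype.val hAB))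

end DualMap

/-- A stable set `C` of `P` is cut out by `ρ C`. The same points of `Y`, read in `P'`, cut out a
stable set whose trace on `P` is `λ (ρ C) = C`. -/
theorem exists_hom_of_isInnerSubstructure {P P' : OmegaPolarity Ω}
    (h : IsInnerSubstructure P P') :
    ∃ θ, P'.dual.IsHom P.dual.toOmegaLattice θ ∧ Function.Surjective θ := by
  obtain ⟨A, B, hP, hb⟩ := h
  obtain ⟨P, hst⟩ := P
  subst hP
  refine ⟨dualMap (P := ⟨P'.restrict A B, hst⟩) hb, isHom_dualMap _, fun C => ?_⟩
  refine ⟨⟨lowerPolar P'.R (Subtype.val '' upperPolar (P'.restrict A B).R C.1),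
    isExtent_lowerPolar⟩, Subtype.ext (Set.ext fun x => ?_)⟩
  refine Iff.trans ?_ (Set.ext_iff.1 (isExtent_iff.1 C.2) x)
  constructor
  · exact fun hx y hy => hx ⟨y, hy, rfl⟩
  · rintro hx _ ⟨y, hy, rfl⟩
    exact hx hy

/-! ### Direct sums as products of dual algebras -/

section DirectSum

variable {J : Type u} (P : J → OmegaPolarity Ω)

theorem directSum_R_self {k : J} (x : (P k).X) (y : (P k).Y) :
    (directSum P).R ⟨k, x⟩ ⟨k, y⟩ ↔ (P k).R x y :=
  PolarityStructure.directSum_R_self (fun j => (P j).toPolarityStructure) x y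

/-- Points of different summands are always related, so only points of the summand `j` can violate a
conclusion, and there the back conditions are tested at the point itself. The dual maps play the
role of the projections of a product. -/
theorem isBoundedMorphism_directSum (j : J) :
    (P j).IsBoundedMorphism (directSum P).toPolarityStructure
      (fun x => ⟨j, x⟩) (fun y => ⟨j, y⟩) where
  isotone₁ x z h := by
    rintro ⟨k, y⟩ hy
    by_cases hk : j = k
    · subst hk
      rintro _ rfl
      refine (directSum_R_self P z y).2 (h ?_ rfl)
      rintro a rfl
      exact (directSum_R_self P a y).1 (hy rfl)
    · rintro _ rfl
      exact Or.inl hk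
  isotone₂ y w h := by
    rintro ⟨k, x⟩ hx
    by_cases hk : k = j
    · subst hk
      rintro _ rfl
      refine (directSum_R_self P x w).2 (h ?_ rfl)
      rintro a rfl
      exact (directSum_R_self P x a).1 (hx rfl)
    · rintro _ rfl
      exact Or.inl hk
  R₁ x y := (directSum_R_self P x y).1
  R₂ := by
    rintro ⟨k, x⟩ y h
    by_cases hk : k = j
    · subst hk
      exact (directSum_R_self P x y).2 (h x subset_rfl)
    · exact Or.inl hk
  R₃ := by
    rintro x ⟨k, y⟩ h
    by_cases hk : j = k
    · subst hk
      exact (directSum_R_self P x y).2 (h y subset_rfl)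
    · exact Or.inl hk
  S₁ f x y := (PolarityStructure.directSum_S_self (fun j => (P j).toPolarityStructure) f x y).1
  S₂ f p y h := by
    by_contra hc
    obtain ⟨x, rfl, hx⟩ := PolarityStructure.exists_of_not_directSum_S _ hc
    exact hx (h x fun i => subset_rfl)
  T₁ g x y := (PolarityStructure.directSum_T_self (fun j => (P j).toPolarityStructure) g x y).1
  T₂ g x q h := by
    by_contra hc
    obtain ⟨y, rfl, hy⟩ := PolarityStructure.exists_of_not_directSum_T _ hc
    exact hy (h y fun i => subset_rfl)

/-- The stable set of a direct sum whose components are given. -/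
def sigmaStable (A : ∀ j, StableSet (P j).R) : StableSet (directSum P).R :=
  ⟨{p | p.2 ∈ (A p.1).1}, by
    rw [isExtent_iff_forall_notMem]
    rintro ⟨j, x⟩ hx
    obtain ⟨y, hy, hxy⟩ := isExtent_iff_forall_notMem.1 (A j).2 x hx
    refine ⟨⟨j, y⟩, ?_, fun h => hxy ((directSum_R_self P x y).1 h)⟩
    rintro ⟨k, z⟩ hz
    by_cases hk : k = j
    · subst hk
      exact (directSum_R_self P z y).2 (hy hz)
    · exact Or.inl hk⟩

/-- The traces on the summands are homomorphisms, and together they determine a stable set. -/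
theorem satisfies_directSum {ν : Type v} {s t : OmegaTerm Ω ν}
    (h : ∀ j, (P j).dual.Satisfies s t) : (directSum P).dual.Satisfies s t := by
  intro a
  refine Subtype.ext (Set.ext ?_)
  rintro ⟨j, x⟩
  have := h j fun k => dualMap (isBoundedMorphism_directSum P j) (a k)
  rw [← (isHom_dualMap (isBoundedMorphism_directSum P j)).map_eval,
    ← (isHom_dualMap (isBoundedMorphism_directSum P j)).map_eval] at this
  exact Set.ext_iff.1 (congrArg Subtype.val this) x

end DirectSum

end OmegaPolarity

/-! ### From homomorphisms to bounded morphisms of canonical structures -/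

namespace OmegaNLO

variable {Ω : OmegaSignature.{u}}

section CanonicalMap

variable {L M : OmegaNLO Ω} {θ : L.carrier → M.carrier}

/-- The principal ideal of `a` meets `F` exactly when `a ∈ F`, so it tests membership of `a`. -/
theorem le₁_iff {F G : PFilter L.carrier} : L.canonicalBase.le₁ F G ↔ F ≤ G := by
  refine ⟨fun h a ha => ?_, ?_⟩
  · have hF : Ideal.principal a ∈ upperPolar L.canonicalBase.R {F} :=
      fun _ hF => hF ▸ ⟨a, ha, Ideal.mem_principal_self⟩
    obtain ⟨b, hb, hba⟩ := h hF rfl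
    exact PFilter.mem_of_le hba hb
  · rintro h D hD _ rfl
    obtain ⟨a, ha, haD⟩ := hD rfl
    exact ⟨a, h ha, haD⟩

theorem le₂_iff {D E : Ideal L.carrier} : L.canonicalBase.le₂ D E ↔ D ≤ E := by
  refine ⟨fun h a ha => ?_, ?_⟩
  · have hD : PFilter.principal a ∈ lowerPolar L.canonicalBase.R {D} :=
      fun _ hD => hD ▸ ⟨a, PFilter.mem_principal.2 le_rfl, ha⟩
    obtain ⟨b, hab, hb⟩ := h hD rfl
    exact E.lower hab hb
  · rintro h F hF _ rfl
    obtain ⟨a, haF, ha⟩ := hF rfl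
    exact ⟨a, haF, h ha⟩

theorem isPFilter_preimage (h : L.IsHom M.toOmegaLattice θ) (F : PFilter M.carrier) :
    IsPFilter (θ ⁻¹' F) := by
  refine IsPFilter.of_def ⟨⊤, ?_⟩ (fun a ha b hb => ⟨a ⊓ b, ?_, inf_le_left, inf_le_right⟩)
    (fun hab ha => PFilter.mem_of_le (h.mono hab) ha)
  · rw [Set.mem_preimage, h.map_top]
    exact PFilter.top_mem
  · rw [Set.mem_preimage, h.map_inf]
    exact PFilter.inf_mem ha hb

theorem isIdeal_preimage (h : L.IsHom M.toOmegaLattice θ) (D : Ideal M.carrier) :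
    IsIdeal (θ ⁻¹' D) := by
  refine ⟨fun a b hba ha => D.lower (h.mono hba) ha, ⟨⊥, ?_⟩,
    fun a ha b hb => ⟨a ⊔ b, ?_, le_sup_left, le_sup_right⟩⟩
  · rw [Set.mem_preimage, h.map_bot]
    exact D.bot_mem
  · rw [Set.mem_preimage, h.map_sup]
    exact Ideal.sup_mem ha hb

/-- The preimage of a filter under a homomorphism. -/
def comapFilter (h : L.IsHom M.toOmegaLattice θ) (F : PFilter M.carrier) : PFilter L.carrier :=
  (isPFilter_preimage h F).toPFilter

/-- The preimage of an ideal under a homomorphism. -/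
def comapIdeal (h : L.IsHom M.toOmegaLattice θ) (D : Ideal M.carrier) : Ideal L.carrier :=
  (isIdeal_preimage h D).toIdeal

theorem mem_comapFilter (h : L.IsHom M.toOmegaLattice θ) {F : PFilter M.carrier} {a : L.carrier} :
    a ∈ comapFilter h F ↔ θ a ∈ F := Iff.rfl

theorem mem_comapIdeal (h : L.IsHom M.toOmegaLattice θ) {D : Ideal M.carrier} {a : L.carrier} :
    a ∈ comapIdeal h D ↔ θ a ∈ D := Iff.rfl

/-- The filter that is generated by the image of a filter. -/
def mapFilter (h : L.IsHom M.toOmegaLattice θ) (F : PFilter L.carrier) : PFilter M.carrier :=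
  (IsPFilter.of_def (F := {b | ∃ a ∈ F, θ a ≤ b}) ⟨⊤, ⊤, PFilter.top_mem, le_top⟩
    (by
      rintro _ ⟨a, ha, hab⟩ _ ⟨c, hc, hcd⟩
      refine ⟨θ (a ⊓ c), ⟨_, PFilter.inf_mem ha hc, le_rfl⟩, ?_, ?_⟩
      · exact (h.mono inf_le_left).trans hab
      · exact (h.mono inf_le_right).trans hcd)
    (by
      rintro b c hbc ⟨a, ha, hab⟩
      exact ⟨a, ha, hab.trans hbc⟩)).toPFilter

/-- The ideal that is generated by the image of an ideal. -/
def mapIdeal (h : L.IsHom M.toOmegaLattice θ) (D : Ideal L.carrier) : Ideal M.carrier :=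
  IsIdeal.toIdeal (I := {b | ∃ a ∈ D, b ≤ θ a}) ⟨by
      rintro b c hbc ⟨a, ha, hab⟩
      exact ⟨a, ha, hbc.trans hab⟩, ⟨⊥, ⊥, D.bot_mem, bot_le⟩, by
      rintro _ ⟨a, ha, hab⟩ _ ⟨c, hc, hcd⟩
      refine ⟨θ (a ⊔ c), ⟨_, Ideal.sup_mem ha hc, le_rfl⟩, ?_, ?_⟩
      · exact hab.trans (h.mono le_sup_left)
      · exact hcd.trans (h.mono le_sup_right)⟩

theorem le_comapFilter_mapFilter (h : L.IsHom M.toOmegaLattice θ) (F : PFilter L.carrier) :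
    F ≤ comapFilter h (mapFilter h F) := fun a ha => ⟨a, ha, le_rfl⟩

theorem le_comapIdeal_mapIdeal (h : L.IsHom M.toOmegaLattice θ) (D : Ideal L.carrier) :
    D ≤ comapIdeal h (mapIdeal h D) := fun a ha => ⟨a, ha, le_rfl⟩

/-- A homomorphism induces a bounded morphism of canonical structures. -/
theorem isBoundedMorphism_comap (h : L.IsHom M.toOmegaLattice θ) :
    M.canonicalBase.IsBoundedMorphism L.canonicalBase (comapFilter h) (comapIdeal h) where
  isotone₁ F G hFG := le₁_iff.2 fun a ha => le₁_iff.1 hFG ha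
  isotone₂ D E hDE := le₂_iff.2 fun a ha => le₂_iff.1 hDE ha
  R₁ F D := fun ⟨a, ha, haD⟩ => ⟨θ a, ha, haD⟩
  -- Each back condition is used at a single point or tuple: the filters or ideals generated by the
  -- images of the given ones. Witnesses found there are bounded by images of elements of `L`.
  R₂ F D hD := by
    obtain ⟨b, ⟨a, ha, hab⟩, hb⟩ := hD _ (le₁_iff.2 (le_comapFilter_mapFilter h F))
    exact ⟨a, ha, D.lower hab hb⟩
  R₃ F D hF := by
    obtain ⟨b, hb, ⟨a, ha, hab⟩⟩ := hF _ (le₂_iff.2 (le_comapIdeal_mapIdeal h D))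
    exact ⟨a, PFilter.mem_of_le (F := F) hab hb, ha⟩
  S₁ f F D := fun ⟨a, ha, haD⟩ => ⟨fun i => θ (a i), ha, h.map_low f a ▸ haD⟩
  S₂ f F D hD := by
    obtain ⟨b, hb, hbD⟩ := hD _ fun i => le₁_iff.2 (le_comapFilter_mapFilter h (F i))
    choose a ha hab using hb
    refine ⟨a, ha, ?_⟩
    rw [mem_comapIdeal, h.map_low]
    exact D.lower ((M.low_normal f).mono hab) hbD
  T₁ g F D := fun ⟨a, ha, haF⟩ => ⟨fun i => θ (a i), ha, h.map_up g a ▸ haF⟩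
  T₂ g F D hF := by
    obtain ⟨b, hb, hbF⟩ := hF _ fun i => le₂_iff.2 (le_comapIdeal_mapIdeal h (D i))
    choose a ha hab using hb
    refine ⟨a, ha, ?_⟩
    rw [mem_comapFilter, h.map_up]
    exact PFilter.mem_of_le ((M.up_normal g).mono hab) hbF

/-- An injective homomorphism reflects the order, so the filter generated by the image of `F` pulls
back to `F` and nothing more. -/
theorem comapFilter_surjective (h : L.IsHom M.toOmegaLattice θ) (hθ : Function.Injective θ) :
    Function.Surjective (comapFilter h) := fun F => by
  refine ⟨mapFilter h F, le_antisymm ?_ (le_comapFilter_mapFilter h F)⟩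
  rintro a ⟨b, hb, hba⟩
  have : b ≤ a := by
    rw [← inf_eq_left]
    exact hθ ((h.map_inf b a).trans (inf_eq_left.2 hba))
  exact PFilter.mem_of_le this hb

theorem comapFilter_injective (h : L.IsHom M.toOmegaLattice θ) (hθ : Function.Surjective θ) :
    Function.Injective (comapFilter h) := fun _ _ hFG => PFilter.ext _ _ <|
  hθ.preimage_injective (congrArg (fun H : PFilter L.carrier => (H : Set L.carrier)) hFG)

theorem comapIdeal_injective (h : L.IsHom M.toOmegaLattice θ) (hθ : Function.Surjective θ) :
    Function.Injective (comapIdeal h) := fun _ _ hDE => SetLike.coe_injective <|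
  hθ.preimage_injective (congrArg (fun H : Ideal L.carrier => (H : Set L.carrier)) hDE)

/-- For a surjective homomorphism `L → M`, the structure `M₊` is isomorphic to a substructure
of `L₊`. -/
noncomputable def isoRestrict (h : L.IsHom M.toOmegaLattice θ) (hθ : Function.Surjective θ) :
    PolarityStructure.Iso M.canonicalBase
      (L.canonicalBase.restrict (Set.range (comapFilter h)) (Set.range (comapIdeal h))) where
  toX := Equiv.ofInjective _ (comapFilter_injective h hθ)
  toY := Equiv.ofInjective _ (comapIdeal_injective h hθ)
  R_iff F D := by
    refine ⟨(isBoundedMorphism_comap h).R₁ F D, ?_⟩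
    rintro ⟨b, hb, hbD⟩
    obtain ⟨a, rfl⟩ := hθ b
    exact ⟨a, hb, hbD⟩
  S_iff f F D := by
    refine ⟨(isBoundedMorphism_comap h).S₁ f F D, ?_⟩
    rintro ⟨b, hb, hbD⟩
    choose a ha using fun i => hθ (b i)
    obtain rfl : (fun i => θ (a i)) = b := funext ha
    exact ⟨a, hb, show θ (L.low f a) ∈ D from h.map_low f a ▸ hbD⟩
  T_iff g F D := by
    refine ⟨(isBoundedMorphism_comap h).T₁ g F D, ?_⟩
    rintro ⟨b, hb, hbF⟩
    choose a ha using fun i => hθ (b i)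
    obtain rfl : (fun i => θ (a i)) = b := funext ha
    exact ⟨a, hb, show θ (L.up g a) ∈ F from h.map_up g a ▸ hbF⟩

/-- For a surjective homomorphism `L → M`, the structure `M₊` is isomorphic to an inner
substructure of `L₊`. -/
theorem exists_innerSubstructure_iso (h : L.IsHom M.toOmegaLattice θ)
    (hθ : Function.Surjective θ) :
    ∃ Q : OmegaPolarity Ω, IsInnerSubstructure Q L.canonicalStructure ∧
      Nonempty (PolarityStructure.Iso Q.toPolarityStructure M.canonicalBase) := by
  let e := isoRestrict h hθ
  -- The inclusion of the image is the inverse isomorphism followed by the morphism that `θ`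
  -- induces, hence a composite of bounded morphisms.
  exact ⟨⟨_, e.sectionsStable M.canonicalStructure.stable⟩, ⟨_, _, rfl, by
    convert (isBoundedMorphism_comap h).comp e.symm.isBoundedMorphism using 1
    · exact funext fun x => (congrArg Subtype.val (e.toX.apply_symm_apply x)).symm
    · exact funext fun y => (congrArg Subtype.val (e.toY.apply_symm_apply y)).symm⟩, ⟨e.symm⟩⟩

end CanonicalMap

/-! ### The embedding of an algebra in its canonical extension -/

section Embedding

variable (L : OmegaNLO Ω)

/-- The principal filter of `a` is the decisive test. With its mirror image this makes the filters
and the ideals containing `a` polars of each other. -/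
theorem mem_upperPolar_setOf_mem (a : L.carrier) (D : Ideal L.carrier) :
    D ∈ upperPolar L.canonicalBase.R {F : PFilter L.carrier | a ∈ F} ↔ a ∈ D := by
  refine ⟨fun h => ?_, fun h F hF => ⟨a, hF, h⟩⟩
  obtain ⟨b, hb, hbD⟩ := h (show PFilter.principal a ∈ {F : PFilter L.carrier | a ∈ F} from
    PFilter.mem_principal.2 le_rfl)
  exact D.lower hb hbD

theorem mem_lowerPolar_setOf_mem (a : L.carrier) (F : PFilter L.carrier) :
    F ∈ lowerPolar L.canonicalBase.R {D : Ideal L.carrier | a ∈ D} ↔ a ∈ F := by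
  refine ⟨fun h => ?_, fun h D hD => ⟨a, h, hD⟩⟩
  obtain ⟨b, hb, hba⟩ := h (show Ideal.principal a ∈ {D : Ideal L.carrier | a ∈ D} from
    Ideal.mem_principal_self)
  exact PFilter.mem_of_le hba hb

/-- The canonical embedding of `L` in `(L₊)⁺`. -/
def embedding (a : L.carrier) : L.canonicalStructure.dual.carrier :=
  ⟨{F : PFilter L.carrier | a ∈ F}, by
    have := Set.ext (mem_lowerPolar_setOf_mem L a)
    exact this ▸ isExtent_lowerPolar⟩

theorem embedding_injective : Function.Injective L.embedding := fun a b hab => by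
  have key : ∀ F : PFilter L.carrier, a ∈ F ↔ b ∈ F :=
    Set.ext_iff.1 (congrArg Subtype.val hab)
  exact le_antisymm ((key (PFilter.principal a)).1 (PFilter.mem_principal.2 le_rfl))
    ((key (PFilter.principal b)).2 (PFilter.mem_principal.2 le_rfl))

/-- Joins reduce to ideals containing both elements. The operators are tested at tuples of principal
filters or ideals, and monotonicity replaces the witness found there by `a`. -/
theorem isHom_embedding : L.IsHom L.canonicalStructure.dual.toOmegaLattice L.embedding where
  map_bot := by
    refine le_antisymm (fun F hF D _ => ⟨⊥, hF, D.bot_mem⟩) bot_le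
  map_top := by
    refine le_antisymm le_top (fun F _ => PFilter.top_mem)
  map_inf a b := by
    refine Subtype.ext (Set.ext fun (F : PFilter L.carrier) => ?_)
    exact PFilter.inf_mem_iff
  map_sup a b := by
    refine le_antisymm ?_ (sup_le ?_ ?_)
    · intro F hF D hD
      have ha := (mem_upperPolar_setOf_mem L a D).1 fun F hF => hD (Or.inl hF)
      have hb := (mem_upperPolar_setOf_mem L b D).1 fun F hF => hD (Or.inr hF)
      exact ⟨a ⊔ b, hF, Ideal.sup_mem ha hb⟩
    · exact fun (F : PFilter L.carrier) hF => PFilter.mem_of_le le_sup_left hF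
    · exact fun (F : PFilter L.carrier) hF => PFilter.mem_of_le le_sup_right hF
  map_low f a := by
    refine le_antisymm ?_ ?_
    · intro F hF D hD
      obtain ⟨b, hb, hbD⟩ := hD (fun i => PFilter.principal (a i)) fun i =>
        PFilter.mem_principal.2 le_rfl
      exact ⟨_, hF, D.lower ((L.low_normal f).mono hb) hbD⟩
    · refine fun F hF => (mem_lowerPolar_setOf_mem L _ F).1 fun D hD => hF fun G hG => ?_
      exact ⟨a, hG, hD⟩
  map_up g a := by
    refine le_antisymm ?_ ?_
    · exact fun F hF D hD => ⟨a, fun i => (mem_upperPolar_setOf_mem L _ _).1 (hD i), hF⟩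
    · intro F hF
      obtain ⟨b, hb, hbF⟩ := hF (fun i => Ideal.principal (a i)) fun i =>
        (mem_upperPolar_setOf_mem L _ _).2 Ideal.mem_principal_self
      exact PFilter.mem_of_le ((L.up_normal g).mono hb) hbF

end Embedding

/-! ### Maximal filters and covering morphisms -/

/-- A filter that is disjoint from an ideal extends to a filter that is maximal with this
property. -/
theorem exists_isIMaximal_ge (L : OmegaNLO Ω) (F : PFilter L.carrier) (D : Ideal L.carrier)
    (h : Disjoint (F : Set L.carrier) (D : Set L.carrier)) :
    ∃ G, F ≤ G ∧ L.IsIMaximal G ∧ Disjoint (G : Set L.carrier) (D : Set L.carrier) := by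
  obtain ⟨G, hFG, hG⟩ := zorn_le_nonempty₀
    {G : PFilter L.carrier | Disjoint (G : Set L.carrier) (D : Set L.carrier)} (fun c hc hch G hG => by
      have hU : IsPFilter (⋃ H ∈ c, (H : Set L.carrier)) := by
        refine IsPFilter.of_def ⟨⊤, Set.mem_biUnion hG PFilter.top_mem⟩ ?_ ?_
        · intro a ha b hb
          obtain ⟨H, hH, ha⟩ := Set.mem_iUnion₂.1 ha
          obtain ⟨K, hK, hb⟩ := Set.mem_iUnion₂.1 hb
          rcases hch.total hH hK with hle | hle
          · exact ⟨a ⊓ b, Set.mem_biUnion hK (PFilter.inf_mem (hle ha) hb), inf_le_left,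
              inf_le_right⟩
          · exact ⟨a ⊓ b, Set.mem_biUnion hH (PFilter.inf_mem ha (hle hb)), inf_le_left,
              inf_le_right⟩
        · intro a b hab ha
          obtain ⟨H, hH, ha⟩ := Set.mem_iUnion₂.1 ha
          exact Set.mem_biUnion hH (PFilter.mem_of_le hab ha)
      exact ⟨hU.toPFilter, Set.disjoint_iUnion₂_left.2 fun H hH => hc hH,
        fun H hH a ha => Set.mem_biUnion hH ha⟩) F h
  exact ⟨G, hFG, ⟨D, hG⟩, hG.prop⟩

end OmegaNLO

/-- The i-maximal filters suffice to tell stable sets apart. If `F ∈ A` is separated from `B` by an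
ideal `D`, enlarge `F` to a filter `G` maximal among those disjoint from `D`: then `G ∈ A` by upward
closure, `G ∉ B`, and `G` lies in the image of `α`. -/
theorem IsMaximalCoveringMorphism.dualMap_injective {Ω : OmegaSignature.{u}} {P : OmegaPolarity Ω}
    {L : OmegaNLO Ω} {α : P.X → PFilter L.carrier} {β : P.Y → Ideal L.carrier}
    (h : IsMaximalCoveringMorphism P L α β) :
    Function.Injective (OmegaPolarity.dualMap (P' := L.canonicalStructure) h.1) := by
  have key : ∀ A B : StableSet L.canonicalBase.R, α ⁻¹' A.1 ⊆ α ⁻¹' B.1 → A ≤ B := by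
    intro A B hAB (F : PFilter L.carrier) hF
    by_contra hFB
    obtain ⟨D, hD, hFD⟩ := isExtent_iff_forall_notMem.1 B.2 F hFB
    obtain ⟨G, hFG, hG, hGD⟩ := L.exists_isIMaximal_ge F D
      (Set.disjoint_left.2 fun a ha ha' => hFD ⟨a, ha, ha'⟩)
    obtain ⟨x, rfl⟩ := h.2 G hG
    obtain ⟨a, ha, haD⟩ :=
      hD (hAB (PolarityStructure.mem_of_le₁ A.2 hF (OmegaNLO.le₁_iff.2 hFG)))
    exact Set.disjoint_left.1 hGD ha haD
  exact fun A B hAB => le_antisymm (key A B (congrArg Subtype.val hAB).le)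
    (key B A (congrArg Subtype.val hAB).ge)

/-! ### Birkhoff's argument and the equivalence -/

/-- An `Ω`-NLO that satisfies the equations of the dual algebras of a class closed under direct
sums is a homomorphic image of a subalgebra of such a dual algebra. -/
theorem ClosedUnderDirectSums.exists_span {Ω : OmegaSignature.{u}} {S : Set (OmegaPolarity Ω)}
    (hS : ClosedUnderDirectSums S) (L : OmegaNLO Ω)
    (hL : ∀ s t : OmegaTerm Ω ℕ, (∀ P ∈ S, P.dual.Satisfies s t) → L.Satisfies s t) :
    ∃ Q ∈ S, ∃ (A : OmegaNLO Ω) (ι : A.carrier → Q.dual.carrier) (π : A.carrier → L.carrier),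
      A.IsHom Q.dual.toOmegaLattice ι ∧ Function.Injective ι ∧
      A.IsHom L.toOmegaLattice π ∧ Function.Surjective π := by
  -- The elements of `L` serve as variables. Indexing by the refutable equations, with one
  -- counterexample each, keeps the index type in the universe that direct sums allow.
  let T := OmegaTerm Ω L.carrier
  let J := {e : T × T // ∃ P ∈ S, ¬ P.dual.Satisfies e.1 e.2}
  have hJ : ∀ j : J, ∃ P ∈ S, ∃ a : L.carrier → P.dual.carrier,
      j.1.1.eval P.dual.toOmegaLattice a ≠ j.1.2.eval P.dual.toOmegaLattice a := by
    rintro ⟨e, P, hP, h⟩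
    exact ⟨P, hP, not_forall.1 h⟩
  choose P hP a ha using hJ
  refine ⟨.directSum P, hS J P hP, L.exists_span (OmegaPolarity.directSum P).dual
    (fun k => OmegaPolarity.sigmaStable P fun j => a j k) id Function.surjective_id ?_⟩
  -- An equation true under the combined assignment cannot be refutable in `S`, since its own
  -- summand would refute it. It is therefore valid in `S`; rewritten in countably many variables it
  -- passes to `L`, where it is evaluated at `id`.
  intro s t hst
  obtain ⟨s', t', h'⟩ := s.exists_nat_equation t
  refine (h' _).2 (hL s' t' fun P' hP' => (h' _).1 ?_) id
  by_contra hc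
  let j : J := ⟨(s, t), P', hP', hc⟩
  have := congrArg (OmegaPolarity.dualMap (OmegaPolarity.isBoundedMorphism_directSum P j)) hst
  rw [(OmegaPolarity.isHom_dualMap (OmegaPolarity.isBoundedMorphism_directSum P j)).map_eval,
    (OmegaPolarity.isHom_dualMap (OmegaPolarity.isBoundedMorphism_directSum P j)).map_eval] at this
  exact ha j this

theorem mainTheorem1 {Ω : OmegaSignature.{u}} (S : Set (OmegaPolarity Ω))
    (hS : ClosedUnderCanonicalExtensions S) :
    List.TFAE [
      ∃ V : Set (OmegaLattice Ω), IsVariety V ∧ S = {P | P.dual.toOmegaLattice ∈ V},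
      ReflectsCanonicalExtensions S ∧ ClosedUnderDirectSums S ∧
        ClosedUnderInnerSubstructures S ∧ ClosedUnderMaximalCoveringCodomains S,
      ReflectsCanonicalExtensions S ∧ ClosedUnderDirectSums S ∧
        ClosedUnderInnerSubstructures S ∧ ClosedUnderSurjectiveImages S] := by
  tfae_have 1 → 3 := by
    rintro ⟨_, ⟨E, rfl⟩, rfl⟩
    refine ⟨fun P hP e he => ?_, fun J P hP e he => ?_, fun P P' h hP' e he => ?_,
      fun P P' α β h hα hP e he => ?_⟩
    · exact P.dual.isHom_embedding.satisfies_of_injective P.dual.embedding_injective (hP e he)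
    · exact OmegaPolarity.satisfies_directSum P fun j => hP j e he
    · obtain ⟨θ, hθ, hsurj⟩ := OmegaPolarity.exists_hom_of_isInnerSubstructure h
      exact hθ.satisfies_of_surjective hsurj (hP' e he)
    · exact (OmegaPolarity.isHom_dualMap h).satisfies_of_injective
        (OmegaPolarity.dualMap_injective h hα) (hP e he)
  tfae_have 3 → 2 := by
    rintro ⟨hrefl, hsum, hinner, hsurj⟩
    -- The covering `α` need not be surjective, but its dual map is injective, so the induced map
    -- from `(P⁺)₊` to the canonical extension of `L₊` is surjective on filters. This uses closure
    -- under canonical extensions, then reflection.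
    refine ⟨hrefl, hsum, hinner, fun P L α β h hP => hrefl _ ?_⟩
    have hθ := OmegaPolarity.isHom_dualMap (P' := L.canonicalStructure) h.1
    exact hsurj _ _ _ _ (OmegaNLO.isBoundedMorphism_comap hθ)
      (OmegaNLO.comapFilter_surjective hθ h.dualMap_injective) (hS P hP)
  tfae_have 2 → 1 := by
    rintro ⟨hrefl, hsum, hinner, hcov⟩
    refine ⟨_, ⟨{e | ∀ P ∈ S, P.dual.Satisfies e.1 e.2}, rfl⟩, Set.Subset.antisymm
      (fun P hP e he => he P hP) fun P hP => hrefl P ?_⟩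
    obtain ⟨Q, hQ, A, ι, π, hι, hinj, hπ, hsurj⟩ :=
      hsum.exists_span P.dual fun s t h => hP (s, t) h
    -- The subalgebra inclusion `ι` induces a morphism that reaches every filter of `A`, in
    -- particular the i-maximal ones.
    have hA : A.canonicalStructure ∈ S :=
      hcov Q.canonicalExtension A (OmegaNLO.comapFilter hι) (OmegaNLO.comapIdeal hι)
        ⟨OmegaNLO.isBoundedMorphism_comap hι,
          fun F _ => OmegaNLO.comapFilter_surjective hι hinj F⟩ (hS Q hQ)
    obtain ⟨Q', hQ', ⟨e⟩⟩ := OmegaNLO.exists_innerSubstructure_iso hπ hsurj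
    -- Closure under isomorphism is not assumed; an isomorphism onto `(P⁺)₊` is itself a maximal
    -- covering morphism.
    exact hcov Q' P.dual e.toX e.toY ⟨e.isBoundedMorphism, fun F _ => e.toX.surjective F⟩
      (hinner _ _ hQ' hA)
  tfae_finish
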